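/- For $\alpha,\beta>0$ and $\theta\in\mathbb R$ put $\gamma=\pi\alpha\sqrt\beta$. Index vectors of length $n$ by the positions $x=-\lfloor n/2\rfloor,\dots,\lceil n/2\rceil-1$. Let $H^{(n)}_{\alpha,\beta,\theta}$ be the $n\times n$ tridiagonal matrix with diagonal entries $2\beta\cos(2\pi\alpha x+\theta)$ and ones on the two side diagonals, and let $P^{(n)}_{\alpha,\beta,\theta}$ be the same matrix with additional ones in the upper right and lower left corners. For $m\ge 0$, let $r\in\{0,1\}$ be the parity of $m$, and let $$\varphi_m(x)=e^{-\gamma x^2}\sum_{l=0}^{(m-r)/2}(\sqrt\gamma)^{2l+r}\,c_{m,l}\,x^{2l+r},\qquad c_{m,l}=\frac{m!\,(2\sqrt2)^{2l+r}(-1)^{\frac{m-r}2-l}}{(2l+r)!\,(\frac{m-r}2-l)!},\qquad x\in\mathbb R.$$ Let $\varphi_{m,n}$ be the function on $\mathbb R$ of period $n$ that agrees with $\varphi_m$ on $[-\frac n2,\frac n2)$. Put $\lambda_m=2\beta+2e^{-\gamma}-4m\gamma e^{-\gamma}$. **Theorem.** Let $0<\varepsilon<1$. In the following, $n$, $\alpha$,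 $\beta$ are always assumed to satisfy $\frac4{n^{2-\varepsilon}}<\gamma<\frac1{n^\varepsilon}$. 1. For every $N$ there is a constant $C>0$, depending only on $N$ and $\varepsilon$, such that the following holds for all $n,\alpha,\beta,\theta$ and all $0\le m\le N$. Put $s=\frac{\theta}{2\pi\alpha}$ and let $v$ be the vector with entries $v(x)=\varphi_{m,n}(x+s)$ (so $v=\varphi_{m,n}$ if $\theta=0$). If $A=H^{(n)}_{\alpha,\beta,\theta}$ or $A=P^{(n)}_{\alpha,\beta,\theta}$, and $$|s|+\sqrt{n^\varepsilon/\gamma}\le\tfrac n2$$ (which always holds if $\theta=0$), then for all positions $x$ $$\bigl|(Av)(x)-\lambda_m v(x)\bigr|\le C\Bigl(1+\frac1\beta\Bigr)\gamma^2 .$$ For $A=P^{(n)}_{\alpha,\beta,\theta}$ the same bound also holds for every $\theta\in\mathbb R$ if $\alpha n\in\mathbb Z$. 2. For every $m$ there are constants $C_1,C_2>0$, independent of $n$, $\alpha$ and $\beta$, such that $|\varphi_{m,n}(x)|\le C_1e^{-C_2\sqrt\gamma\,|x|}$ for all positions $x$. 3. For every $m\ge0$ with $m<n^\varepsilon-1$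 (in particular for all $m\le N$ as soon as $n>(N+1)^{1/\varepsilon}$), the entries of $\varphi_{m,n}$, in the order of the positions, change sign exactly $m$ times, zero entries being ignored. -/

import Mathlib

open scoped Matrix

/-- The number `γ = π α √β`. -/
noncomputable def amoGamma (α β : ℝ) : ℝ := Real.pi * α * √β

/-- The position in `ℤ` of the `k`-th entry of a vector of length `n`. The positions run through
`-n/2, …, n/2 - 1` if `n` is even, and through `-(n-1)/2, …, (n-1)/2` if `n` is odd. -/
def latticePos (n : ℕ) (k : Fin n) : ℤ := ((k : ℕ) : ℤ) - ((n / 2 : ℕ) : ℤ)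

/-- The coefficient `c_{m,l}`. With `r = m % 2` and `m / 2 = (m - r) / 2` this is
`m! (2√2)^(2l+r) (-1)^((m-r)/2-l) / ((2l+r)! ((m-r)/2-l)!)`, for `0 ≤ l ≤ (m-r)/2`. -/
noncomputable def hermiteCoeff (m l : ℕ) : ℝ :=
  ((m.factorial : ℝ) * (2 * √2) ^ (2 * l + m % 2) * (-1) ^ (m / 2 - l)) /
    (((2 * l + m % 2).factorial : ℝ) * ((m / 2 - l).factorial : ℝ))

/-- The scaled Hermite function `φ_m` with parameter `γ`, for a real argument. -/
noncomputable def scaledHermite (γ : ℝ) (m : ℕ) (x : ℝ) : ℝ :=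
  Real.exp (-(γ * x ^ 2)) *
    ∑ l ∈ Finset.range (m / 2 + 1), √γ ^ (2 * l + m % 2) * hermiteCoeff m l * x ^ (2 * l + m % 2)

/-- The periodic Hermite function `φ_{m,n}`: the function on `ℝ` of period `n` that agrees with
`φ_m` on `[-n/2, n/2)`. -/
noncomputable def periodicHermite (n : ℕ) (γ : ℝ) (m : ℕ) (y : ℝ) : ℝ :=
  scaledHermite γ m (y - (n : ℝ) * (⌊y / (n : ℝ) + 1 / 2⌋ : ℝ))

/-- The vector of length `n` whose entry at the position `x` is `φ_{m,n}(x + s)`. -/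
noncomputable def hermiteVec (n : ℕ) (γ : ℝ) (m : ℕ) (s : ℝ) : Fin n → ℝ :=
  fun k => periodicHermite n γ m ((latticePos n k : ℝ) + s)

/-- The finite almost Mathieu operator `H^{(n)}_{α,β,θ}` (tridiagonal). -/
noncomputable def finiteMathieu (n : ℕ) (α β θ : ℝ) : Matrix (Fin n) (Fin n) ℝ :=
  Matrix.of fun i j =>
    if i = j then 2 * β * Real.cos (2 * Real.pi * α * (latticePos n i : ℝ) + θ)
    else if (i : ℕ) + 1 = (j : ℕ) ∨ (j : ℕ) + 1 = (i : ℕ) then 1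
    else 0

/-- The periodic almost Mathieu operator `P^{(n)}_{α,β,θ}` (for `n ≥ 3`: the tridiagonal matrix
with additional entries `1` in the two corners). -/
noncomputable def periodicMathieu (n : ℕ) (α β θ : ℝ) : Matrix (Fin n) (Fin n) ℝ :=
  Matrix.of fun i j =>
    if i = j then 2 * β * Real.cos (2 * Real.pi * α * (latticePos n i : ℝ) + θ)
    else if ((i : ℕ) + 1) % n = (j : ℕ) ∨ ((j : ℕ) + 1) % n = (i : ℕ) then 1
    else 0

/-- The approximate eigenvalue `λ_m = 2β + 2e^{-γ} - 4mγe^{-γ}`. -/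
noncomputable def approxEigenvalue (β γ : ℝ) (m : ℕ) : ℝ :=
  2 * β + 2 * Real.exp (-γ) - 4 * (m : ℝ) * γ * Real.exp (-γ)

/-- The number of sign changes of a finite real sequence, zero entries being ignored: the number of
pairs of entries of opposite signs with only zeros strictly between them. -/
noncomputable def signChanges {n : ℕ} (v : Fin n → ℝ) : ℕ :=
  Set.ncard {p : Fin n × Fin n |
    p.1 < p.2 ∧ v p.1 * v p.2 < 0 ∧ ∀ k : Fin n, p.1 < k → k < p.2 → v k = 0}

/-! In the variable `u = 2√γ x`, `φ_m` is `√2 ^ m` times `g(u) = e^{-u²/4} He_m(u)`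
(`scaledHermite_eq`), and Hermite's equation becomes the oscillator equation `g'' = (u²/4 - m - 1/2)
g`. One lattice step is a step `2√γ` in `u`, so the second difference is `4γ g''` up to `O(γ²)`,
while `2β(cos - 1)` is `-γu²` up to `O(γ²u⁴/β)`. The quadratic terms cancel, and what remains, `2β +
2 - 2γ - 4mγ`, is `λ_m` up to `O(γ²)` (`exists_scaledHermite_approx`).

Wrapping modulo `n` and deleting the corner entries matter only at distance about `√(n^ε/γ)` or more
from the centre. There `φ_m` is `O(n⁻⁴)` (`exists_scaledHermite_tail`), which is `O(γ²)` because
`γn² ≥ 1`. The Gaussian factor also gives the exponential decay.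

For the sign changes, `He_m` has `m` simple real roots, all with `u² ≤ 4(m-1)`. Between two roots
the oscillator equation gives `|g''| ≤ (m + 1/2) max |g|`, which forces the distance `d` of the
roots to satisfy `(m+1)d² > 4` (`four_lt_mul_sq_sub_of_realHermite_roots`). In the variable `x` the
gaps then exceed 1, so sampling at integers sees each root exactly once
(`signChanges_latticePos_eq_card`). -/

/-- The probabilists' Hermite polynomial with real coefficients. -/
noncomputable def realHermite (m : ℕ) : Polynomial ℝ :=
  (Polynomial.hermite m).map (Int.castRingHom ℝ)

/-! ### Hermite polynomials: recurrences, coefficients and roots. -/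

section HermitePolynomials

open Polynomial

theorem realHermite_zero : realHermite 0 = 1 := by simp [realHermite]

theorem realHermite_succ (m : ℕ) :
    realHermite (m + 1) = X * realHermite m - derivative (realHermite m) := by
  simp [realHermite, hermite_succ, derivative_map]

theorem derivative_realHermite_succ (m : ℕ) :
    derivative (realHermite (m + 1)) = C ((m : ℝ) + 1) * realHermite m := by
  induction m with
  | zero => simp [realHermite_succ, realHermite_zero]
  | succ m ih =>
    rw [realHermite_succ (m + 1), derivative_sub, derivative_mul, ih, derivative_X, one_mul,
      derivative_C_mul, realHermite_succ m]
    push_cast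
    simp only [map_add, map_one]
    ring

theorem realHermite_succ_succ (m : ℕ) :
    realHermite (m + 2) = X * realHermite (m + 1) - C ((m : ℝ) + 1) * realHermite m := by
  rw [realHermite_succ (m + 1), derivative_realHermite_succ]

theorem realHermite_monic (m : ℕ) : (realHermite m).Monic := (hermite_monic m).map _

theorem natDegree_realHermite (m : ℕ) : (realHermite m).natDegree = m := by
  rw [realHermite, (hermite_monic m).natDegree_map, natDegree_hermite]

/-- Hermite's differential equation. -/
theorem realHermite_ode (m : ℕ) :
    derivative (derivative (realHermite m)) =
      X * derivative (realHermite m) - C (m : ℝ) * realHermite m := by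
  cases m with
  | zero => simp [realHermite_zero]
  | succ m =>
    have h := congrArg derivative (realHermite_succ (m + 1))
    rw [derivative_realHermite_succ, derivative_sub, derivative_mul, derivative_X] at h
    have : derivative (derivative (realHermite (m + 1))) =
        1 * realHermite (m + 1) + X * derivative (realHermite (m + 1))
          - C (((m + 1 : ℕ) : ℝ) + 1) * realHermite (m + 1) := by rw [h]; ring
    rw [this]
    push_cast
    simp only [map_add, map_one]
    ring

/-- Converts the coefficients `(2n-1)!! · choose (2n+k) k` of `He_m` into the factorial quotient of
`hermiteCoeff`, via `(2n)! = (2n-1)!! 2^n n!`. -/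
theorem doubleFactorial_choose_mul (n k : ℕ) :
    Nat.doubleFactorial (2 * n - 1) * (2 * n + k).choose k * 2 ^ n * n.factorial * k.factorial =
      (2 * n + k).factorial := by
  have h1 : (2 * n).factorial = Nat.doubleFactorial (2 * n - 1) * (2 ^ n * n.factorial) := by
    rcases Nat.eq_zero_or_pos n with rfl | hn
    · simp
    · obtain ⟨j, rfl⟩ : ∃ j, n = j + 1 := ⟨n - 1, by omega⟩
      rw [← Nat.doubleFactorial_two_mul, show 2 * (j + 1) = 2 * j + 1 + 1 by ring,
        Nat.factorial_eq_mul_doubleFactorial, Nat.add_sub_cancel, mul_comm]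
  have h2 := Nat.choose_mul_factorial_mul_factorial (show k ≤ 2 * n + k by omega)
  rw [Nat.add_sub_cancel, h1] at h2
  rw [← h2]
  ring

theorem scaledHermite_eq (γ : ℝ) (hγ : 0 ≤ γ) (m : ℕ) (x : ℝ) :
    scaledHermite γ m x =
      √2 ^ m * (Real.exp (-((2 * √γ * x) ^ 2 / 4)) * (realHermite m).eval (2 * √γ * x)) := by
  have he : -((2 * √γ * x) ^ 2 / 4) = -(γ * x ^ 2) := by
    rw [mul_pow, mul_pow, Real.sq_sqrt hγ]; ring
  rw [scaledHermite, he, mul_left_comm]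
  congr 1
  rw [eval_eq_sum_range, natDegree_realHermite, Finset.mul_sum]
  -- Only the exponents of the parity of `m` contribute to `He_m`.
  refine Finset.sum_of_injOn (fun l => 2 * l + m % 2) (fun a _ b _ h => by simpa using h)
    (fun l hl => ?_) (fun j hj hj' => ?_) (fun l hl => ?_)
  · simp only [Finset.coe_range, Set.mem_Iio] at hl ⊢
    omega
  · have : coeff (hermite m) j = 0 := by
      refine coeff_hermite_of_odd_add ?_
      by_contra h
      apply hj'
      simp only [Finset.coe_range, Set.mem_image, Set.mem_Iio, Finset.mem_range] at hj ⊢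
      rw [Nat.not_odd_iff_even, Nat.even_iff] at h
      exact ⟨j / 2, by omega, by omega⟩
    simp [realHermite, this]
  · simp only [Finset.mem_range] at hl
    obtain ⟨n, hn⟩ : ∃ n, n = m / 2 - l := ⟨_, rfl⟩
    obtain ⟨k, hk⟩ : ∃ k, k = 2 * l + m % 2 := ⟨_, rfl⟩
    have hm : m = 2 * n + k := by omega
    have hc : (realHermite m).coeff k =
        (-1) ^ n * (Nat.doubleFactorial (2 * n - 1) : ℝ) * ((2 * n + k).choose k : ℝ) := by
      rw [hm, realHermite, coeff_map, coeff_hermite_explicit]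
      simp
    have hs : √(2 : ℝ) ^ m = 2 ^ n * √2 ^ k := by
      rw [hm, pow_add, pow_mul, Real.sq_sqrt zero_le_two]
    have hf : (m.factorial : ℝ) = (Nat.doubleFactorial (2 * n - 1) : ℝ) *
        ((2 * n + k).choose k : ℝ) * 2 ^ n * (n.factorial : ℝ) * (k.factorial : ℝ) := by
      rw [hm]; exact_mod_cast (doubleFactorial_choose_mul n k).symm
    rw [hermiteCoeff, ← hk, ← hn, hc, hs, hf]
    have h1 : (n.factorial : ℝ) ≠ 0 := by positivity
    have h2 : (k.factorial : ℝ) ≠ 0 := by positivity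
    field_simp
    ring

/-- Put `a_k = He_k(u) u^k`. In `a_{k+2} = u²(a_{k+1} - (k+1) a_k)` the subtracted term is at most
half of `a_{k+1}` when `a_{k+1} ≥ (u²/2) a_k` and `u² > 4(m-1)`. So this growth propagates up to `k
= m` and keeps `a_k` positive. -/
theorem realHermite_eval_ne_zero_of_sq {m : ℕ} {u : ℝ} (hu : 4 * ((m : ℝ) - 1) < u ^ 2) :
    (realHermite m).eval u ≠ 0 := by
  rcases Nat.eq_zero_or_pos m with rfl | hm
  · simp [realHermite_zero]
  have hm1 : (1 : ℝ) ≤ m := by exact_mod_cast hm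
  have hu0 : 0 < u ^ 2 := by linarith
  have key : ∀ k, k < m → 0 < (realHermite k).eval u * u ^ k ∧
      u ^ 2 / 2 * ((realHermite k).eval u * u ^ k) ≤
        (realHermite (k + 1)).eval u * u ^ (k + 1) := by
    intro k
    induction k with
    | zero =>
      intro _
      simp only [realHermite_zero, realHermite_succ]
      norm_num
      nlinarith
    | succ k ih =>
      intro hk
      obtain ⟨h0, h1⟩ := ih (by omega)
      have hk' : ((k : ℝ) + 1) ≤ m - 1 := by
        have : ((k + 1 + 1 : ℕ) : ℝ) ≤ m := by exact_mod_cast hk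
        push_cast at this; linarith
      have hpos : 0 < (realHermite (k + 1)).eval u * u ^ (k + 1) :=
        lt_of_lt_of_le (by positivity) h1
      refine ⟨hpos, ?_⟩
      rw [realHermite_succ_succ]
      simp only [eval_sub, eval_mul, eval_X, eval_C]
      have h2 : ((k : ℝ) + 1) * ((realHermite k).eval u * u ^ k) ≤
          1 / 2 * ((realHermite (k + 1)).eval u * u ^ (k + 1)) := by
        nlinarith
      have h3 := mul_le_mul_of_nonneg_left h2 hu0.le
      calc _ ≤ u ^ 2 * ((realHermite (k + 1)).eval u * u ^ (k + 1)) -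
          u ^ 2 * (((k : ℝ) + 1) * ((realHermite k).eval u * u ^ k)) := by linarith
        _ = _ := by ring
  obtain ⟨k, rfl⟩ : ∃ k, m = k + 1 := ⟨m - 1, by omega⟩
  obtain ⟨h0, h1⟩ := key k (by omega)
  intro h
  rw [h, zero_mul] at h1
  have : 0 < u ^ 2 / 2 * ((realHermite k).eval u * u ^ k) := by positivity
  linarith

theorem sq_le_of_realHermite_eval_eq_zero {m : ℕ} {u : ℝ} (h : (realHermite m).eval u = 0) :
    u ^ 2 ≤ 4 * ((m : ℝ) - 1) :=
  not_lt.1 fun hu => realHermite_eval_ne_zero_of_sq hu h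

/-- A common root would descend through the three-term recurrence to `He_0 = 1`. -/
theorem realHermite_no_common_root (m : ℕ) (u : ℝ) (h0 : (realHermite m).eval u = 0) :
    (realHermite (m + 1)).eval u ≠ 0 := by
  induction m with
  | zero => simp [realHermite_zero] at h0
  | succ m ih =>
    intro h1
    rw [realHermite_succ_succ] at h1
    simp only [eval_sub, eval_mul, eval_X, eval_C, h0, mul_zero, zero_sub, neg_eq_zero,
      mul_eq_zero] at h1
    rcases h1 with h1 | h1
    · have : (0 : ℝ) < m + 1 := by positivity
      linarith
    · exact ih h1 h0

theorem realHermite_derivative_ne_zero {m : ℕ} {u : ℝ} (h : (realHermite m).eval u = 0) :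
    (derivative (realHermite m)).eval u ≠ 0 := by
  intro h'
  refine realHermite_no_common_root m u h ?_
  simp [realHermite_succ, h, h']

theorem im_one_div_sub_ofReal (w : ℂ) (r : ℝ) :
    (1 / (w - r)).im * w.im ≤ 0 := by
  have : (1 / (w - r)).im = -w.im / Complex.normSq (w - r) := by
    rw [one_div, Complex.inv_im]; simp
  rw [this, div_mul_eq_mul_div]
  refine div_nonpos_of_nonpos_of_nonneg ?_ (Complex.normSq_nonneg _)
  nlinarith [sq_nonneg w.im]

/-- With `p = He_m`, a root `w` of `He_{m+1} = Xp - p'` that is not a root of `p` satisfies `w =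
p'(w)/p(w) = ∑ 1/(w - z)` over the real roots `z` of `p`. Each summand has imaginary part of sign
opposite to `Im w`, so `Im w = 0`. -/
theorem realHermite_map_root_im (m : ℕ) :
    ∀ w : ℂ, ((realHermite m).map Complex.ofRealHom).eval w = 0 → w.im = 0 := by
  induction m with
  | zero => intro w h; simp [realHermite_zero] at h
  | succ m ih =>
    intro w h
    by_contra hw
    set p := (realHermite m).map Complex.ofRealHom with hp
    have hpw : p.eval w ≠ 0 := fun h0 => hw (ih w h0)
    have hs : (realHermite (m + 1)).map Complex.ofRealHom = X * p - derivative p := by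
      rw [realHermite_succ, hp, derivative_map]; simp
    rw [hs, eval_sub, eval_mul, eval_X, sub_eq_zero] at h
    have hq := (IsAlgClosed.splits p).eval_derivative_div_eval_of_ne_zero hpw
    rw [← h, mul_div_cancel_right₀ _ hpw] at hq
    have hsum : ((p.roots.map fun z => 1 / (w - z)).sum).im * w.im ≤ 0 := by
      have : ∀ s : Multiset ℂ, (∀ z ∈ s, z.im = 0) →
          ((s.map fun z => 1 / (w - z)).sum).im * w.im ≤ 0 := by
        intro s
        induction s using Multiset.induction_on with
        | empty => simp
        | cons a s ihs =>
          intro hz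
          rw [Multiset.map_cons, Multiset.sum_cons, Complex.add_im, add_mul]
          have h1 := ihs fun z hzs => hz z (Multiset.mem_cons_of_mem hzs)
          have ha : a = ((a.re : ℝ) : ℂ) :=
            Complex.ext (by simp) (by simpa using hz a (Multiset.mem_cons_self a s))
          have h2 := im_one_div_sub_ofReal w a.re
          rw [← ha] at h2
          linarith
      exact this _ fun z hz => ih z (isRoot_of_mem_roots hz)
    rw [← hq] at hsum
    exact hw (by nlinarith [mul_self_nonneg w.im])

theorem realHermite_splits (m : ℕ) : (realHermite m).Splits := by
  refine Splits.of_splits_map Complex.ofRealHom (IsAlgClosed.splits _) fun a ha => ?_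
  exact ⟨a.re, Complex.ext (by simp)
    (by simpa using (realHermite_map_root_im m a (isRoot_of_mem_roots ha)).symm)⟩

theorem realHermite_roots_nodup (m : ℕ) : (realHermite m).roots.Nodup := by
  rw [Multiset.nodup_iff_count_le_one]
  intro a
  rw [count_roots]
  by_contra h
  have h2 : 1 < (realHermite m).rootMultiplicity a := by omega
  rw [one_lt_rootMultiplicity_iff_isRoot (realHermite_monic m).ne_zero] at h2
  exact realHermite_derivative_ne_zero h2.1 h2.2

theorem card_realHermite_roots (m : ℕ) : (realHermite m).roots.toFinset.card = m := by
  rw [Multiset.toFinset_card_of_nodup (realHermite_roots_nodup m),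
    ← (realHermite_splits m).natDegree_eq_card_roots, natDegree_realHermite]

end HermitePolynomials

/-! ### Polynomials times a Gaussian: oscillator equation, bounds, second differences. -/

section GaussianPolynomials

open Polynomial

/-- The product of a polynomial and the Gaussian `exp (-u² / 4)`. -/
noncomputable def gaussPoly (p : Polynomial ℝ) (u : ℝ) : ℝ :=
  Real.exp (-(u ^ 2 / 4)) * p.eval u

/-- The operation on polynomials that corresponds to differentiating `gaussPoly`. -/
noncomputable def gaussDeriv (p : Polynomial ℝ) : Polynomial ℝ :=
  derivative p - C (1 / 2) * X * p

theorem hasDerivAt_gaussPoly (p : Polynomial ℝ) (u : ℝ) :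
    HasDerivAt (gaussPoly p) (gaussPoly (gaussDeriv p) u) u := by
  have h1 : HasDerivAt (fun u : ℝ => -(u ^ 2 / 4)) (-(u / 2)) u := by
    convert! ((hasDerivAt_pow 2 u).div_const 4).neg using 1
    norm_num
    ring
  convert! h1.exp.mul (p.hasDerivAt u) using 1
  simp only [gaussPoly, gaussDeriv, eval_sub, eval_mul, eval_C, eval_X]
  ring

/-- The Gaussian factor removes the first-order term of Hermite's equation. -/
theorem gaussDeriv_gaussDeriv_realHermite (m : ℕ) :
    gaussDeriv (gaussDeriv (realHermite m)) =
      (C (1 / 4) * X ^ 2 - C ((m : ℝ) + 1 / 2)) * realHermite m := by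
  have h4 : (C (1 / 4 : ℝ) : Polynomial ℝ) = C (1 / 2) * C (1 / 2) := by
    rw [← C_mul]; norm_num
  have h1 : (C (1 / 2 : ℝ) : Polynomial ℝ) + C (1 / 2) = 1 := by
    rw [← C_add]; norm_num
  simp only [gaussDeriv, derivative_sub, derivative_mul, derivative_C, derivative_X, zero_mul,
    zero_add, mul_one]
  rw [realHermite_ode, h4, C_add]
  linear_combination (-(X * derivative (realHermite m))) * h1

theorem gaussPoly_gaussDeriv_gaussDeriv (m : ℕ) (u : ℝ) :
    gaussPoly (gaussDeriv (gaussDeriv (realHermite m))) u =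
      (u ^ 2 / 4 - m - 1 / 2) * gaussPoly (realHermite m) u := by
  rw [gaussDeriv_gaussDeriv_realHermite]
  simp only [gaussPoly, eval_sub, eval_mul, eval_C, eval_X, eval_pow]
  ring

theorem exists_abs_eval_le (p : Polynomial ℝ) :
    ∃ K : ℝ, 0 < K ∧ ∀ u : ℝ, |p.eval u| ≤ K * Real.exp (u ^ 2 / 8) := by
  induction p using Polynomial.induction_on' with
  | add p q hp hq =>
    obtain ⟨K, hK, hp⟩ := hp
    obtain ⟨L, hL, hq⟩ := hq
    refine ⟨K + L, by positivity, fun u => ?_⟩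
    rw [eval_add, add_mul]
    exact (abs_add_le _ _).trans (add_le_add (hp u) (hq u))
  | monomial k a =>
    refine ⟨(|a| + 1) * (1 + 8 ^ k * k.factorial), by positivity, fun u => ?_⟩
    have h1 : |u| ^ k ≤ (1 + 8 ^ k * k.factorial) * Real.exp (u ^ 2 / 8) := by
      have h2 := Real.pow_div_factorial_le_exp (u ^ 2 / 8) (by positivity) k
      have h3 : 1 ≤ Real.exp (u ^ 2 / 8) := Real.one_le_exp (by positivity)
      have h4 : |u| ^ k ≤ 1 + (u ^ 2) ^ k := by
        have : (u ^ 2) ^ k = (|u| ^ k) ^ 2 := by rw [← sq_abs, ← pow_mul, ← pow_mul, mul_comm]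
        rw [this]
        nlinarith [sq_nonneg (|u| ^ k - 1), sq_nonneg (|u| ^ k)]
      have h5 : (u ^ 2) ^ k ≤ 8 ^ k * k.factorial * Real.exp (u ^ 2 / 8) := by
        rw [div_pow, div_div, div_le_iff₀ (by positivity)] at h2
        linarith
      linarith
    rw [eval_monomial, abs_mul, abs_pow]
    calc |a| * |u| ^ k ≤ (|a| + 1) * ((1 + 8 ^ k * k.factorial) * Real.exp (u ^ 2 / 8)) := by
          gcongr; linarith
      _ = _ := by ring

/-- Half of the Gaussian exponent is spent on absorbing the polynomial. -/
theorem exists_abs_gaussPoly_le (p : Polynomial ℝ) :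
    ∃ K : ℝ, 0 < K ∧ ∀ u : ℝ, |gaussPoly p u| ≤ K * Real.exp (-(u ^ 2 / 8)) := by
  obtain ⟨K, hK, h⟩ := exists_abs_eval_le p
  refine ⟨K, hK, fun u => ?_⟩
  rw [gaussPoly, abs_mul, Real.abs_exp]
  calc _ ≤ Real.exp (-(u ^ 2 / 4)) * (K * Real.exp (u ^ 2 / 8)) := by gcongr; exact h u
    _ = K * (Real.exp (-(u ^ 2 / 4)) * Real.exp (u ^ 2 / 8)) := by ring
    _ = _ := by rw [← Real.exp_add]; ring_nf

theorem exists_abs_gaussPoly_le_const (p : Polynomial ℝ) :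
    ∃ K : ℝ, 0 < K ∧ ∀ u : ℝ, |gaussPoly p u| ≤ K := by
  obtain ⟨K, hK, h⟩ := exists_abs_gaussPoly_le p
  refine ⟨K, hK, fun u => (h u).trans ?_⟩
  have : Real.exp (-(u ^ 2 / 8)) ≤ 1 := Real.exp_le_one_iff.2 (by have := sq_nonneg u; linarith)
  nlinarith

/-- A crude integrated bound, by the mean value theorem. -/
theorem abs_le_mul_pow_succ_of_hasDerivAt {F F' : ℝ → ℝ} {c : ℝ} {k : ℕ}
    (hF : ∀ h, HasDerivAt F (F' h) h) (h0 : F 0 = 0) (hc : 0 ≤ c)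
    (hb : ∀ h, 0 ≤ h → |F' h| ≤ c * h ^ k) :
    ∀ h, 0 ≤ h → |F h| ≤ c * h ^ (k + 1) := by
  intro h hh
  have := Convex.norm_image_sub_le_of_norm_hasDerivWithin_le (f := F) (f' := F')
    (s := Set.Icc 0 h) (C := c * h ^ k) (fun x _ => (hF x).hasDerivWithinAt)
    (fun x hx => (hb x hx.1).trans (by have := hx.1; have := hx.2; gcongr))
    (convex_Icc 0 h) (Set.left_mem_Icc.2 hh) (Set.right_mem_Icc.2 hh)
  rw [h0, sub_zero, sub_zero, Real.norm_eq_abs, Real.norm_eq_abs, abs_of_nonneg hh] at this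
  rw [pow_succ, ← mul_assoc]
  exact this

theorem hasDerivAt_gaussPoly_add (p : Polynomial ℝ) (u h : ℝ) :
    HasDerivAt (fun h => gaussPoly p (u + h)) (gaussPoly (gaussDeriv p) (u + h)) h := by
  simpa using (hasDerivAt_gaussPoly p (u + h)).comp_const_add u h

theorem hasDerivAt_gaussPoly_sub (p : Polynomial ℝ) (u h : ℝ) :
    HasDerivAt (fun h => gaussPoly p (u - h)) (-gaussPoly (gaussDeriv p) (u - h)) h := by
  simpa using (hasDerivAt_gaussPoly p (u - h)).comp_const_sub u h

/-- As a function of `h`, the remainder and its first three derivatives vanish at 0, and its fourth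
derivative is a sum of two values bounded by `K`. Integrating four times crudely gives `2Kh⁴`. -/
theorem abs_gaussPoly_second_difference_le (p : Polynomial ℝ) {K : ℝ} (hK : 0 ≤ K)
    (hp : ∀ u, |gaussPoly (gaussDeriv (gaussDeriv (gaussDeriv (gaussDeriv p)))) u| ≤ K)
    (u h : ℝ) (hh : 0 ≤ h) :
    |gaussPoly p (u + h) + gaussPoly p (u - h) - 2 * gaussPoly p u
      - h ^ 2 * gaussPoly (gaussDeriv (gaussDeriv p)) u| ≤ 2 * K * h ^ 4 := by
  set p1 := gaussDeriv p with hp1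
  set p2 := gaussDeriv p1 with hp2
  set p3 := gaussDeriv p2 with hp3
  have hK2 : 0 ≤ 2 * K := by positivity
  have b4 : ∀ h, 0 ≤ h → |gaussPoly (gaussDeriv p3) (u + h) + gaussPoly (gaussDeriv p3) (u - h)| ≤
      2 * K * h ^ 0 := fun h _ => by
    have := abs_add_le (gaussPoly (gaussDeriv p3) (u + h)) (gaussPoly (gaussDeriv p3) (u - h))
    have := hp (u + h)
    have := hp (u - h)
    linarith
  have b3 := abs_le_mul_pow_succ_of_hasDerivAt
    (F := fun h => gaussPoly p3 (u + h) - gaussPoly p3 (u - h))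
    (fun h => by
      convert! (hasDerivAt_gaussPoly_add p3 u h).sub (hasDerivAt_gaussPoly_sub p3 u h) using 1
      ring) (by simp) hK2 b4
  have b2 := abs_le_mul_pow_succ_of_hasDerivAt
    (F := fun h => gaussPoly p2 (u + h) + gaussPoly p2 (u - h) - 2 * gaussPoly p2 u)
    (fun h => by
      convert! ((hasDerivAt_gaussPoly_add p2 u h).add
        (hasDerivAt_gaussPoly_sub p2 u h)).sub_const _ using 1)
    (by simp; ring) hK2 b3
  have b1 := abs_le_mul_pow_succ_of_hasDerivAt
    (F := fun h => gaussPoly p1 (u + h) - gaussPoly p1 (u - h) - h * (2 * gaussPoly p2 u))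
    (fun h => by
      convert! ((hasDerivAt_gaussPoly_add p1 u h).sub
        (hasDerivAt_gaussPoly_sub p1 u h)).sub
        ((hasDerivAt_id h).mul_const (2 * gaussPoly p2 u)) using 1
      ring) (by simp) hK2 b2
  have b0 := abs_le_mul_pow_succ_of_hasDerivAt
    (F := fun h => gaussPoly p (u + h) + gaussPoly p (u - h) - 2 * gaussPoly p u
      - h ^ 2 * gaussPoly p2 u)
    (fun h => by
      convert! (((hasDerivAt_gaussPoly_add p u h).add
        (hasDerivAt_gaussPoly_sub p u h)).sub_const (2 * gaussPoly p u)).sub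
        ((hasDerivAt_pow 2 h).mul_const (gaussPoly p2 u)) using 1
      norm_num
      ring) (by simp; ring) hK2 b1
  exact b0 h hh

end GaussianPolynomials

/-! ### The approximate eigenvalue equation on the whole line. -/

theorem abs_cos_sub_one_add_sq_half_le (t : ℝ) : |Real.cos t - 1 + t ^ 2 / 2| ≤ t ^ 4 := by
  rw [abs_le]
  have h1 := Real.one_sub_sq_div_two_le_cos (x := t)
  have h4 : 0 ≤ t ^ 4 := by positivity
  refine ⟨by linarith, ?_⟩
  rcases le_total |t| 1 with h | h
  · have := (abs_le.1 (Real.cos_bound h)).2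
    have e : |t| ^ 4 = t ^ 4 := by
      rw [show |t| ^ 4 = (|t| ^ 2) ^ 2 by ring, sq_abs]; ring
    rw [e] at this
    linarith
  · have := Real.cos_le_one t
    have h2 : 1 ≤ t ^ 2 := by rw [← sq_abs]; nlinarith
    nlinarith

theorem abs_two_mul_cos_sub_le {β : ℝ} (hβ : 0 < β) (t : ℝ) :
    |2 * β * Real.cos t - 2 * β| ≤ β * t ^ 2 := by
  have h1 := Real.one_sub_sq_div_two_le_cos (x := t)
  have h2 := Real.cos_le_one t
  rw [abs_le]
  constructor <;> nlinarith

theorem amoGamma_sq (α : ℝ) {β : ℝ} (hβ : 0 < β) :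
    amoGamma α β ^ 2 = (Real.pi * α) ^ 2 * β := by
  rw [amoGamma, mul_pow, Real.sq_sqrt hβ.le]

theorem amoGamma_pos {α β : ℝ} (hα : 0 < α) (hβ : 0 < β) : 0 < amoGamma α β := by
  have := Real.pi_pos
  unfold amoGamma
  positivity

/-- In the whole line, the scaled Hermite function is an approximate eigenfunction. -/
theorem exists_scaledHermite_approx (m : ℕ) :
    ∃ C : ℝ, 0 < C ∧ ∀ α β : ℝ, 0 < α → 0 < β → amoGamma α β ≤ 1 → ∀ y : ℝ,
      |scaledHermite (amoGamma α β) m (y + 1) + scaledHermite (amoGamma α β) m (y - 1)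
          + 2 * β * Real.cos (2 * Real.pi * α * y) * scaledHermite (amoGamma α β) m y
          - approxEigenvalue β (amoGamma α β) m * scaledHermite (amoGamma α β) m y|
        ≤ C * (1 + 1 / β) * amoGamma α β ^ 2 := by
  obtain ⟨K₁, hK₁, h1⟩ := exists_abs_gaussPoly_le_const
    (gaussDeriv (gaussDeriv (gaussDeriv (gaussDeriv (realHermite m)))))
  -- The quartic Taylor error of the cosine is paid for by boundedness of `u⁴ g(u)`.
  obtain ⟨K₂, hK₂, h2⟩ := exists_abs_gaussPoly_le_const (Polynomial.X ^ 4 * realHermite m)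
  obtain ⟨K₃, hK₃, h3⟩ := exists_abs_gaussPoly_le_const (realHermite m)
  have hs2 : (0 : ℝ) < √2 ^ m := by positivity
  refine ⟨√2 ^ m * (32 * K₁ + 2 * K₂ + (2 + 4 * m) * K₃), by positivity, ?_⟩
  intro α β hα hβ hγ1 y
  have hγ := amoGamma_pos hα hβ
  have hγsq := amoGamma_sq α hβ
  set γ := amoGamma α β
  set u := 2 * √γ * y with hu
  have hsq : √γ ^ 2 = γ := Real.sq_sqrt hγ.le
  have hu2 : u ^ 2 = 4 * γ * y ^ 2 := by rw [hu, mul_pow, mul_pow, hsq]; ring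
  have hh2 : (2 * √γ) ^ 2 = 4 * γ := by rw [mul_pow, hsq]; ring
  have hh4 : (2 * √γ) ^ 4 = 16 * γ ^ 2 := by
    rw [show (2 * √γ) ^ 4 = ((2 * √γ) ^ 2) ^ 2 by ring, hh2]; ring
  have f1 : scaledHermite γ m (y + 1) = √2 ^ m * gaussPoly (realHermite m) (u + 2 * √γ) := by
    rw [scaledHermite_eq γ hγ.le, show 2 * √γ * (y + 1) = u + 2 * √γ by rw [hu]; ring]; rfl
  have f2 : scaledHermite γ m (y - 1) = √2 ^ m * gaussPoly (realHermite m) (u - 2 * √γ) := by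
    rw [scaledHermite_eq γ hγ.le, show 2 * √γ * (y - 1) = u - 2 * √γ by rw [hu]; ring]; rfl
  have f0 : scaledHermite γ m y = √2 ^ m * gaussPoly (realHermite m) u := by
    rw [scaledHermite_eq γ hγ.le]; rfl
  have hT := abs_gaussPoly_second_difference_le (realHermite m) hK₁.le h1 u (2 * √γ) (by positivity)
  rw [gaussPoly_gaussDeriv_gaussDeriv, hh2, hh4] at hT
  have hX := h2 u
  have hXe : gaussPoly (Polynomial.X ^ 4 * realHermite m) u
      = u ^ 4 * gaussPoly (realHermite m) u := by
    simp [gaussPoly]; ring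
  rw [hXe] at hX
  set t := 2 * Real.pi * α * y with ht
  -- This identity makes the quadratic part of the cosine cancel the `u²/4` of the oscillator
  -- exactly. Its square is the source of the factor `1/β`.
  have ht2 : β * t ^ 2 = γ * u ^ 2 := by
    rw [ht, hu2]
    linear_combination (-4 * y ^ 2) * hγsq
  have hβt4 : β * t ^ 4 = 1 / β * γ ^ 2 * u ^ 4 := by
    field_simp
    linear_combination (β * t ^ 2 + γ * u ^ 2) * ht2
  have hc := abs_cos_sub_one_add_sq_half_le t
  have h3u := h3 u
  rw [f1, f2, f0]
  set g := gaussPoly (realHermite m) u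
  set gp := gaussPoly (realHermite m) (u + 2 * √γ)
  set gm := gaussPoly (realHermite m) (u - 2 * √γ)
  have hexp2 : |Real.exp (-γ) - 1 + γ| ≤ γ ^ 2 := by
    have := Real.abs_exp_sub_one_sub_id_le (x := -γ) (by rw [abs_neg, abs_of_pos hγ]; exact hγ1)
    rw [neg_sq, sub_neg_eq_add] at this
    exact this
  have hexp1 : |1 - Real.exp (-γ)| ≤ γ := by
    have := Real.one_sub_le_exp_neg γ
    have := Real.exp_le_one_iff.2 (neg_nonpos.2 hγ.le)
    rw [abs_le]; constructor <;> linarith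
  have e : √2 ^ m * gp + √2 ^ m * gm + 2 * β * Real.cos t * (√2 ^ m * g)
      - approxEigenvalue β γ m * (√2 ^ m * g) =
      √2 ^ m * ((gp + gm - 2 * g - 4 * γ * ((u ^ 2 / 4 - m - 1 / 2) * g))
        + 2 * β * (Real.cos t - 1 + t ^ 2 / 2) * g
        + (-2 * (Real.exp (-γ) - 1 + γ) - 4 * m * γ * (1 - Real.exp (-γ))) * g) := by
    rw [approxEigenvalue]
    linear_combination (-√2 ^ m * g) * ht2
  rw [e, abs_mul, abs_of_pos hs2]
  have p2 : |2 * β * (Real.cos t - 1 + t ^ 2 / 2) * g| ≤ 2 * K₂ * (1 / β) * γ ^ 2 := by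
    rw [abs_mul, abs_mul, abs_of_pos (by positivity : 0 < 2 * β)]
    rw [abs_mul, abs_of_nonneg (by positivity : 0 ≤ u ^ 4)] at hX
    calc _ ≤ 2 * β * t ^ 4 * |g| := by gcongr
      _ = 2 * (1 / β) * γ ^ 2 * (u ^ 4 * |g|) := by linear_combination (2 * |g|) * hβt4
      _ ≤ 2 * (1 / β) * γ ^ 2 * K₂ := by gcongr
      _ = _ := by ring
  have p3 : |(-2 * (Real.exp (-γ) - 1 + γ) - 4 * m * γ * (1 - Real.exp (-γ))) * g| ≤
      (2 + 4 * m) * K₃ * γ ^ 2 := by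
    rw [abs_mul]
    have : |-2 * (Real.exp (-γ) - 1 + γ) - 4 * m * γ * (1 - Real.exp (-γ))| ≤
        (2 + 4 * m) * γ ^ 2 := by
      refine (abs_sub _ _).trans ?_
      rw [abs_mul, abs_mul, abs_of_nonneg (by positivity : 0 ≤ 4 * (m : ℝ) * γ)]
      have : 4 * (m : ℝ) * γ * |1 - Real.exp (-γ)| ≤ 4 * m * γ * γ := by gcongr
      norm_num
      linarith
    calc _ ≤ (2 + 4 * m) * γ ^ 2 * K₃ := by gcongr
      _ = _ := by ring
  have hβ' : 0 < 1 / β := by positivity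
  have hγ2 : 0 < γ ^ 2 := by positivity
  have hfin : |(gp + gm - 2 * g - 4 * γ * ((u ^ 2 / 4 - m - 1 / 2) * g))
        + 2 * β * (Real.cos t - 1 + t ^ 2 / 2) * g
        + (-2 * (Real.exp (-γ) - 1 + γ) - 4 * m * γ * (1 - Real.exp (-γ))) * g|
      ≤ (32 * K₁ + 2 * K₂ + (2 + 4 * m) * K₃) * (1 + 1 / β) * γ ^ 2 := by
    have q1 : 0 ≤ 32 * K₁ * (1 / β) * γ ^ 2 := by positivity
    have q2 : 0 ≤ 2 * K₂ * γ ^ 2 := by positivity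
    have q3 : 0 ≤ (2 + 4 * m) * K₃ * (1 / β) * γ ^ 2 := by positivity
    refine (abs_add_three _ _ _).trans ?_
    linarith
  calc _ ≤ √2 ^ m * ((32 * K₁ + 2 * K₂ + (2 + 4 * m) * K₃) * (1 + 1 / β) * γ ^ 2) := by gcongr
    _ = _ := by ring

/-! ### Residues modulo `n`. -/

/-- The representative of `y` modulo `n` in `[-n/2, n/2)`. -/
noncomputable def centeredResidue (n : ℕ) (y : ℝ) : ℝ :=
  y - (n : ℝ) * (⌊y / (n : ℝ) + 1 / 2⌋ : ℝ)

theorem periodicHermite_eq (n : ℕ) (γ : ℝ) (m : ℕ) (y : ℝ) :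
    periodicHermite n γ m y = scaledHermite γ m (centeredResidue n y) := rfl

section CenteredResidue

variable {n : ℕ}

theorem neg_half_le_centeredResidue (hn : 0 < n) (y : ℝ) : -((n : ℝ) / 2) ≤ centeredResidue n y := by
  have hn' : (0 : ℝ) < n := by exact_mod_cast hn
  have h := mul_le_mul_of_nonneg_left (Int.floor_le (y / n + 1 / 2)) hn'.le
  have e : (n : ℝ) * (y / n + 1 / 2) = y + n / 2 := by field_simp
  unfold centeredResidue
  linarith

theorem centeredResidue_lt_half (hn : 0 < n) (y : ℝ) : centeredResidue n y < (n : ℝ) / 2 := by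
  have hn' : (0 : ℝ) < n := by exact_mod_cast hn
  have h := mul_lt_mul_of_pos_left (Int.lt_floor_add_one (y / n + 1 / 2)) hn'
  have e : (n : ℝ) * (y / n + 1 / 2) = y + n / 2 := by field_simp
  unfold centeredResidue
  linarith

theorem abs_centeredResidue_le_half (hn : 0 < n) (y : ℝ) : |centeredResidue n y| ≤ (n : ℝ) / 2 :=
  abs_le.2 ⟨neg_half_le_centeredResidue hn y, (centeredResidue_lt_half hn y).le⟩

theorem centeredResidue_add_mul_int (hn : 0 < n) (y : ℝ) (j : ℤ) :
    centeredResidue n (y + n * j) = centeredResidue n y := by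
  have hn' : (n : ℝ) ≠ 0 := by positivity
  have e : (y + n * j) / n + 1 / 2 = y / n + 1 / 2 + j := by field_simp; ring
  unfold centeredResidue
  rw [e, Int.floor_add_intCast]
  push_cast
  ring

theorem centeredResidue_eq_self (hn : 0 < n) {y : ℝ} (h1 : -((n : ℝ) / 2) ≤ y)
    (h2 : y < (n : ℝ) / 2) : centeredResidue n y = y := by
  have hn' : (0 : ℝ) < n := by exact_mod_cast hn
  have : ⌊y / (n : ℝ) + 1 / 2⌋ = 0 := by
    rw [Int.floor_eq_zero_iff, Set.mem_Ico]
    have e : y / n + 1 / 2 = (y + n / 2) / n := by field_simp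
    rw [e]
    exact ⟨div_nonneg (by linarith) hn'.le, (div_lt_one hn').2 (by linarith)⟩
  rw [centeredResidue, this, Int.cast_zero, mul_zero, sub_zero]

theorem abs_centeredResidue_le (hn : 0 < n) (y : ℝ) (j : ℤ) :
    |centeredResidue n y| ≤ |y - n * j| := by
  have hn' : (0 : ℝ) < n := by exact_mod_cast hn
  rcases lt_or_ge |y - n * j| (n / 2) with h | h
  · rw [abs_lt] at h
    have := centeredResidue_eq_self hn h.1.le h.2
    have e := centeredResidue_add_mul_int hn (y - n * j) j
    rw [sub_add_cancel, this] at e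
    rw [e]
  · exact (abs_centeredResidue_le_half hn y).trans h

/-- A shift by `d` brings a residue at most `|d|` closer to the centre, even across the cut. -/
theorem abs_centeredResidue_le_add (hn : 0 < n) (y d : ℝ) :
    |centeredResidue n y| ≤ |centeredResidue n (y + d)| + |d| := by
  set j := ⌊(y + d) / (n : ℝ) + 1 / 2⌋ with hj
  have h := abs_centeredResidue_le hn y j
  have e : y - n * j = centeredResidue n (y + d) - d := by
    rw [centeredResidue, ← hj]; ring
  rw [e] at h
  exact h.trans (abs_sub _ _)

end CenteredResidue

/-! ### Decay of the scaled Hermite functions. -/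

section Decay

theorem exists_pow_four_le_exp {ε : ℝ} (hε : 0 < ε) :
    ∃ L : ℝ, 0 < L ∧ ∀ x : ℝ, 1 ≤ x → x ^ 4 ≤ L * Real.exp (x ^ ε / 4) := by
  obtain ⟨k, hk⟩ := exists_nat_ge (4 / ε)
  refine ⟨4 ^ k * k.factorial, by positivity, fun x hx => ?_⟩
  have h0 : 0 ≤ x ^ ε := Real.rpow_nonneg (by linarith) _
  have h1 := Real.pow_div_factorial_le_exp (x ^ ε / 4) (by positivity) k
  rw [div_pow, div_div, div_le_iff₀ (by positivity)] at h1
  have h2 : x ^ 4 ≤ (x ^ ε) ^ k := by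
    rw [← Real.rpow_natCast (x ^ ε), ← Real.rpow_mul (by linarith), ← Real.rpow_natCast x]
    refine Real.rpow_le_rpow_of_exponent_le hx ?_
    rw [div_le_iff₀ hε] at hk
    push_cast
    linarith
  linarith

/-- The threshold is lowered by 2 to leave room for points within 1 of the tail and for their
neighbours. -/
theorem exists_scaledHermite_tail {ε : ℝ} (hε : 0 < ε) (m : ℕ) :
    ∃ K : ℝ, 0 < K ∧ ∀ (n : ℕ) (γ z : ℝ), 1 ≤ n → 0 < γ → γ ≤ 1 →
      √((n : ℝ) ^ ε / γ) - 2 ≤ |z| → (n : ℝ) ^ 4 * |scaledHermite γ m z| ≤ K := by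
  obtain ⟨K, hK, hb⟩ := exists_abs_gaussPoly_le (realHermite m)
  obtain ⟨L, hL, hexp⟩ := exists_pow_four_le_exp hε
  refine ⟨L * √2 ^ m * K * Real.exp 2, by positivity, fun n γ z hn hγ hγ1 hz => ?_⟩
  have hn' : (1 : ℝ) ≤ n := by exact_mod_cast hn
  have hf : scaledHermite γ m z = √2 ^ m * gaussPoly (realHermite m) (2 * √γ * z) :=
    scaledHermite_eq γ hγ.le m z
  have hpos : 0 ≤ (n : ℝ) ^ ε := by positivity
  have hsγ : 0 < √γ := Real.sqrt_pos.2 hγ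
  have hsγ1 : √γ ≤ 1 := Real.sqrt_le_one.2 hγ1
  have ha : √((n : ℝ) ^ ε) - 2 ≤ √γ * |z| := by
    rw [Real.sqrt_div hpos] at hz
    have := mul_le_mul_of_nonneg_left hz hsγ.le
    rw [mul_sub, mul_div_cancel₀ _ hsγ.ne'] at this
    linarith
  -- With `a² = n^ε` this is `4(a-2)² - (2a² - 16) = 2(a-4)² ≥ 0`; for `a ≤ 2` the left side is
  -- negative.
  have hu : 2 * (n : ℝ) ^ ε - 16 ≤ (2 * √γ * z) ^ 2 := by
    have h1 : (2 * √γ * z) ^ 2 = 4 * (√γ * |z|) ^ 2 := by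
      rw [mul_pow √γ, sq_abs]; ring
    rw [h1]
    have h2 := Real.sq_sqrt hpos
    set a := √((n : ℝ) ^ ε)
    have ha0 : 0 ≤ a := Real.sqrt_nonneg _
    rw [← h2]
    rcases le_total 2 a with h | h
    · have : (a - 2) ^ 2 ≤ (√γ * |z|) ^ 2 := pow_le_pow_left₀ (by linarith) ha 2
      nlinarith [sq_nonneg (a - 4)]
    · have := sq_nonneg (√γ * |z|)
      nlinarith
  have h3 : Real.exp (-((2 * √γ * z) ^ 2 / 8)) ≤ Real.exp 2 * Real.exp (-((n : ℝ) ^ ε / 4)) := by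
    rw [← Real.exp_add]
    exact Real.exp_le_exp.2 (by linarith)
  rw [hf, abs_mul, abs_of_pos (by positivity : (0 : ℝ) < √2 ^ m)]
  calc (n : ℝ) ^ 4 * (√2 ^ m * |gaussPoly (realHermite m) (2 * √γ * z)|)
      ≤ (L * Real.exp ((n : ℝ) ^ ε / 4)) *
        (√2 ^ m * (K * (Real.exp 2 * Real.exp (-((n : ℝ) ^ ε / 4))))) := by
        gcongr
        · exact hexp n hn'
        · exact (hb _).trans (by gcongr)
    _ = L * √2 ^ m * K * Real.exp 2 * (Real.exp ((n : ℝ) ^ ε / 4) *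
          Real.exp (-((n : ℝ) ^ ε / 4))) := by ring
    _ = _ := by rw [← Real.exp_add, add_neg_cancel, Real.exp_zero, mul_one]

theorem exists_scaledHermite_exp_decay (m : ℕ) :
    ∃ C₁ : ℝ, 0 < C₁ ∧ ∀ γ x : ℝ, 0 < γ →
      |scaledHermite γ m x| ≤ C₁ * Real.exp (-(1 * √γ * |x|)) := by
  obtain ⟨K, hK, hb⟩ := exists_abs_gaussPoly_le (realHermite m)
  refine ⟨√2 ^ m * K * Real.exp 1, by positivity, fun γ x hγ => ?_⟩
  have hf : scaledHermite γ m x = √2 ^ m * gaussPoly (realHermite m) (2 * √γ * x) :=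
    scaledHermite_eq γ hγ.le m x
  have h1 : -((2 * √γ * x) ^ 2 / 8) ≤ 1 + -(1 * √γ * |x|) := by
    have : (2 * √γ * x) ^ 2 = 4 * (√γ * |x|) ^ 2 := by rw [mul_pow √γ, sq_abs]; ring
    rw [this]
    nlinarith [sq_nonneg (√γ * |x| - 1)]
  rw [hf, abs_mul, abs_of_pos (by positivity : (0 : ℝ) < √2 ^ m)]
  calc _ ≤ √2 ^ m * (K * (Real.exp 1 * Real.exp (-(1 * √γ * |x|)))) := by
        gcongr
        refine (hb _).trans ?_
        rw [← Real.exp_add]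
        gcongr
    _ = _ := by ring

end Decay

/-! ### Consequences of the bounds on `γ`. -/

section Regime

variable {ε γ : ℝ} {n : ℕ}

theorem three_le_of_regime (hε0 : 0 < ε) (hε1 : ε < 1)
    (h1 : 4 / (n : ℝ) ^ (2 - ε) < γ) (h2 : γ < 1 / (n : ℝ) ^ ε) : 3 ≤ n := by
  have h := h1.trans h2
  by_contra hn
  have hn2 : n ≤ 2 := by omega
  rcases Nat.eq_zero_or_pos n with rfl | hpos
  · rw [Nat.cast_zero, Real.zero_rpow hε0.ne', Real.zero_rpow (by linarith)] at h
    simp at h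
  have hn1 : (1 : ℝ) ≤ n := by exact_mod_cast hpos
  have hn2' : (n : ℝ) ≤ 2 := by exact_mod_cast hn2
  have hp : (0 : ℝ) < n := by linarith
  rw [div_lt_div_iff₀ (by positivity) (by positivity), one_mul] at h
  have h3 : (n : ℝ) ^ (2 - ε) ≤ (n : ℝ) ^ (2 : ℝ) :=
    Real.rpow_le_rpow_of_exponent_le hn1 (by linarith)
  have h4 : (1 : ℝ) ≤ (n : ℝ) ^ ε := Real.one_le_rpow hn1 hε0.le
  rw [Real.rpow_two] at h3
  nlinarith

theorem regime_mul_lt_one (hn : 0 < n) (h2 : γ < 1 / (n : ℝ) ^ ε) : γ * (n : ℝ) ^ ε < 1 := by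
  have hp : (0 : ℝ) < n := by exact_mod_cast hn
  rwa [lt_div_iff₀ (by positivity)] at h2

theorem regime_lt_one (hn : 0 < n) (hε : 0 < ε) (hγ : 0 < γ) (h2 : γ < 1 / (n : ℝ) ^ ε) :
    γ < 1 := by
  have h := regime_mul_lt_one hn h2
  have h4 : (1 : ℝ) ≤ (n : ℝ) ^ ε := Real.one_le_rpow (by exact_mod_cast hn) hε.le
  nlinarith

theorem regime_rpow_lt (hn : 0 < n) (h1 : 4 / (n : ℝ) ^ (2 - ε) < γ) :
    4 * (n : ℝ) ^ ε < γ * (n : ℝ) ^ 2 := by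
  have hp : (0 : ℝ) < n := by exact_mod_cast hn
  rw [div_lt_iff₀ (by positivity), Real.rpow_sub hp, Real.rpow_two, mul_div_assoc',
    lt_div_iff₀ (by positivity)] at h1
  exact h1

theorem regime_sqrt_le (hn : 0 < n) (hγ : 0 < γ) (h1 : 4 / (n : ℝ) ^ (2 - ε) < γ) :
    √((n : ℝ) ^ ε / γ) ≤ (n : ℝ) / 2 := by
  have h := regime_rpow_lt hn h1
  refine Real.sqrt_le_iff.2 ⟨by positivity, ?_⟩
  rw [div_le_iff₀ hγ]
  linarith

/-- Turns tail bounds of order `n⁻⁴` into bounds of order `γ²`. -/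
theorem regime_one_le (hn : 0 < n) (hε : 0 < ε) (h1 : 4 / (n : ℝ) ^ (2 - ε) < γ) :
    1 ≤ γ ^ 2 * (n : ℝ) ^ 4 := by
  have h := regime_rpow_lt hn h1
  have h4 : (1 : ℝ) ≤ (n : ℝ) ^ ε := Real.one_le_rpow (by exact_mod_cast hn) hε.le
  have : 1 ≤ (γ * (n : ℝ) ^ 2) ^ 2 := one_le_pow₀ (by linarith)
  calc _ ≤ _ := this
    _ = _ := by ring

end Regime

/-- Approximate eigenvalue equation for the periodic Hermite function on the real line. -/
theorem exists_periodicHermite_approx {ε : ℝ} (hε0 : 0 < ε) (hε1 : ε < 1) (m : ℕ) :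
    ∃ C : ℝ, 0 < C ∧ ∀ (n : ℕ) (α β : ℝ), 0 < α → 0 < β →
      4 / (n : ℝ) ^ (2 - ε) < amoGamma α β → amoGamma α β < 1 / (n : ℝ) ^ ε →
      ∀ y : ℝ, |y| ≤ n → (centeredResidue n y = y ∨
          √((n : ℝ) ^ ε / amoGamma α β) ≤ |centeredResidue n y|) →
      |periodicHermite n (amoGamma α β) m (y + 1) + periodicHermite n (amoGamma α β) m (y - 1)
          + 2 * β * Real.cos (2 * Real.pi * α * y) * periodicHermite n (amoGamma α β) m y
          - approxEigenvalue β (amoGamma α β) m * periodicHermite n (amoGamma α β) m y|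
        ≤ C * (1 + 1 / β) * amoGamma α β ^ 2 := by
  obtain ⟨C, hC, hin⟩ := exists_scaledHermite_approx m
  obtain ⟨K, hK, htail⟩ := exists_scaledHermite_tail hε0 m
  refine ⟨C + (8 + 4 * m) * K, by positivity, ?_⟩
  intro n α β hα hβ h1 h2 y hyn hy
  have hγ := amoGamma_pos hα hβ
  have hn3 := three_le_of_regime hε0 hε1 h1 h2
  have hn : 0 < n := by omega
  have hnr : (0 : ℝ) < n := by exact_mod_cast hn
  have hγ1 := regime_lt_one hn hε0 hγ h2
  have hin := hin α β hα hβ hγ1.le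
  have hγsq := amoGamma_sq α hβ
  have hone := regime_one_le hn hε0 h1
  have hsqrt := regime_sqrt_le hn hγ h1
  set γ := amoGamma α β
  have hβ' : 0 < 1 / β := by positivity
  -- In this case neither `y` nor `y ± 1` is wrapped, and the estimate on the line applies.
  -- Otherwise all three values lie in the tail.
  by_cases hint : centeredResidue n y = y ∧ |y| + 1 < n / 2
  · obtain ⟨hz, hy1⟩ := hint
    have hy2 := abs_le.1 (le_refl |y|)
    simp only [periodicHermite_eq]
    rw [hz, centeredResidue_eq_self hn (by linarith) (by linarith),
      centeredResidue_eq_self hn (by linarith) (by linarith)]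
    refine (hin y).trans ?_
    gcongr
    have : 0 ≤ (8 + 4 * (m : ℝ)) * K := by positivity
    linarith
  · have hz0 : √((n : ℝ) ^ ε / γ) - 1 ≤ |centeredResidue n y| := by
      rcases hy with hy | hy
      · rw [hy]
        have : ¬ (|y| + 1 < n / 2) := fun h => hint ⟨hy, h⟩
        linarith
      · linarith
    have hp := abs_centeredResidue_le_add hn y 1
    have hm := abs_centeredResidue_le_add hn y (-1)
    rw [← sub_eq_add_neg] at hm
    norm_num at hp hm
    have tp := htail n γ (centeredResidue n (y + 1)) hn hγ hγ1.le (by linarith)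
    have tm := htail n γ (centeredResidue n (y - 1)) hn hγ hγ1.le (by linarith)
    have t0 := htail n γ (centeredResidue n y) hn hγ hγ1.le (by linarith)
    simp only [← periodicHermite_eq] at tp tm t0
    set fp := periodicHermite n γ m (y + 1)
    set fm := periodicHermite n γ m (y - 1)
    set f0 := periodicHermite n γ m y
    have small : ∀ a : ℝ, (n : ℝ) ^ 4 * |a| ≤ K → |a| ≤ K * γ ^ 2 := fun a ha => by
      have h3 : |a| * 1 ≤ |a| * (γ ^ 2 * (n : ℝ) ^ 4) := by gcongr
      have h4 : γ ^ 2 * ((n : ℝ) ^ 4 * |a|) ≤ γ ^ 2 * K := by gcongr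
      linarith
    have hcos := abs_two_mul_cos_sub_le hβ (2 * Real.pi * α * y)
    have hcos2 : β * (2 * Real.pi * α * y) ^ 2 ≤ 4 * γ ^ 2 * (n : ℝ) ^ 4 := by
      have : β * (2 * Real.pi * α * y) ^ 2 = 4 * γ ^ 2 * y ^ 2 := by
        linear_combination (-4 * y ^ 2) * hγsq
      rw [this]
      have hy2 : y ^ 2 ≤ (n : ℝ) ^ 2 := by rw [← sq_abs]; gcongr
      have hn1 : (1 : ℝ) ≤ n := by exact_mod_cast hn
      have hn4 : (n : ℝ) ^ 2 ≤ (n : ℝ) ^ 4 := pow_le_pow_right₀ hn1 (by norm_num)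
      gcongr
      linarith
    -- The `2β` of `λ_m` is paired with the cosine, since `β` has no upper bound; `β(cos - 1)` is
    -- only `O(γ²n²)`.
    have e : fp + fm + 2 * β * Real.cos (2 * Real.pi * α * y) * f0 - approxEigenvalue β γ m * f0
        = (fp + fm) + (2 * β * Real.cos (2 * Real.pi * α * y) - 2 * β) * f0
          - (2 * Real.exp (-γ) - 4 * m * γ * Real.exp (-γ)) * f0 := by
      rw [approxEigenvalue]; ring
    have b1 : |(2 * β * Real.cos (2 * Real.pi * α * y) - 2 * β) * f0| ≤ 4 * γ ^ 2 * K := by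
      rw [abs_mul]
      calc _ ≤ 4 * γ ^ 2 * (n : ℝ) ^ 4 * |f0| := by gcongr; exact hcos.trans hcos2
        _ = 4 * γ ^ 2 * ((n : ℝ) ^ 4 * |f0|) := by ring
        _ ≤ _ := by gcongr
    have b2 : |(2 * Real.exp (-γ) - 4 * m * γ * Real.exp (-γ)) * f0| ≤
        (2 + 4 * m) * (K * γ ^ 2) := by
      rw [abs_mul]
      have he1 := Real.exp_le_one_iff.2 (neg_nonpos.2 hγ.le)
      have he0 := Real.exp_pos (-γ)
      have : |2 * Real.exp (-γ) - 4 * m * γ * Real.exp (-γ)| ≤ 2 + 4 * m := by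
        refine (abs_sub _ _).trans ?_
        rw [abs_of_pos (by positivity), abs_of_nonneg (by positivity)]
        have h5 : γ * Real.exp (-γ) ≤ 1 * 1 := by gcongr
        have h6 : 4 * (m : ℝ) * (γ * Real.exp (-γ)) ≤ 4 * m * (1 * 1) := by gcongr
        linarith
      have := small f0 t0
      gcongr
    rw [e]
    have hsum : |fp + fm + (2 * β * Real.cos (2 * Real.pi * α * y) - 2 * β) * f0
        - (2 * Real.exp (-γ) - 4 * m * γ * Real.exp (-γ)) * f0| ≤
        (8 + 4 * m) * K * γ ^ 2 := by
      refine (abs_sub _ _).trans ?_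
      have := abs_add_three fp fm ((2 * β * Real.cos (2 * Real.pi * α * y) - 2 * β) * f0)
      have := small fp tp
      have := small fm tm
      linarith
    refine hsum.trans ?_
    have q1 : 0 ≤ C * (1 + 1 / β) * γ ^ 2 := by positivity
    have q2 : 0 ≤ (8 + 4 * (m : ℝ)) * K * (1 / β) * γ ^ 2 := by positivity
    linarith

/-! ### Action of the two matrices on vectors. -/

section Matrices

variable {n : ℕ}

theorem latticePos_bounds (k : Fin n) :
    -((n : ℝ) / 2) ≤ (latticePos n k : ℝ) ∧ (latticePos n k : ℝ) < (n : ℝ) / 2 := by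
  have hk := k.2
  have h1 : -(n : ℤ) ≤ 2 * latticePos n k := by unfold latticePos; omega
  have h2 : 2 * latticePos n k < n := by unfold latticePos; omega
  have h1' : -(n : ℝ) ≤ 2 * (latticePos n k : ℝ) := by exact_mod_cast h1
  have h2' : 2 * (latticePos n k : ℝ) < n := by exact_mod_cast h2
  constructor <;> linarith

theorem abs_latticePos_le (k : Fin n) : |(latticePos n k : ℝ)| ≤ (n : ℝ) / 2 :=
  abs_le.2 ⟨(latticePos_bounds k).1, (latticePos_bounds k).2.le⟩

theorem centeredResidue_latticePos (hn : 0 < n) (k : Fin n) :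
    centeredResidue n (latticePos n k) = latticePos n k :=
  centeredResidue_eq_self hn (latticePos_bounds k).1 (latticePos_bounds k).2

theorem hermiteVec_zero (hn : 0 < n) (γ : ℝ) (m : ℕ) (k : Fin n) :
    hermiteVec n γ m 0 k = scaledHermite γ m (latticePos n k) := by
  rw [hermiteVec, add_zero, periodicHermite_eq, centeredResidue_latticePos hn]

theorem periodicHermite_add_mul_int (hn : 0 < n) (γ : ℝ) (m : ℕ) (y : ℝ) (j : ℤ) :
    periodicHermite n γ m (y + n * j) = periodicHermite n γ m y := by
  rw [periodicHermite_eq, centeredResidue_add_mul_int hn, periodicHermite_eq]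

/-- The cyclic successor of an index. -/
def cyclicSucc (k : Fin n) : Fin n :=
  ⟨((k : ℕ) + 1) % n, Nat.mod_lt _ (Nat.lt_of_le_of_lt (Nat.zero_le _) k.2)⟩

/-- The cyclic predecessor of an index. -/
def cyclicPred (k : Fin n) : Fin n :=
  ⟨((k : ℕ) + (n - 1)) % n, Nat.mod_lt _ (Nat.lt_of_le_of_lt (Nat.zero_le _) k.2)⟩

theorem add_one_mod_cases {i n : ℕ} (h : i < n) :
    (i + 1 < n ∧ (i + 1) % n = i + 1) ∨ (i + 1 = n ∧ (i + 1) % n = 0) := by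
  rcases Nat.lt_or_ge (i + 1) n with h1 | h1
  · exact Or.inl ⟨h1, Nat.mod_eq_of_lt h1⟩
  · have : i + 1 = n := by omega
    exact Or.inr ⟨this, by rw [this, Nat.mod_self]⟩

theorem add_pred_mod_cases {i n : ℕ} (h : i < n) :
    (0 < i ∧ (i + (n - 1)) % n = i - 1) ∨ (i = 0 ∧ (i + (n - 1)) % n = n - 1) := by
  rcases Nat.eq_zero_or_pos i with rfl | h1
  · exact Or.inr ⟨rfl, by rw [Nat.mod_eq_of_lt] <;> omega⟩
  · refine Or.inl ⟨h1, ?_⟩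
    rw [show i + (n - 1) = (i - 1) + n by omega, Nat.add_mod_right, Nat.mod_eq_of_lt (by omega)]

theorem exists_latticePos_cyclicSucc (k : Fin n) :
    ∃ j : ℤ, latticePos n (cyclicSucc k) = latticePos n k + 1 + n * j := by
  rcases add_one_mod_cases k.2 with ⟨_, h⟩ | ⟨h1, h⟩
  · exact ⟨0, by simp only [latticePos, cyclicSucc, h]; push_cast; ring⟩
  · refine ⟨-1, ?_⟩
    simp only [latticePos, cyclicSucc, h]
    have : ((k : ℕ) : ℤ) + 1 = n := by exact_mod_cast h1
    push_cast
    linarith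

theorem exists_latticePos_cyclicPred (k : Fin n) :
    ∃ j : ℤ, latticePos n (cyclicPred k) = latticePos n k - 1 + n * j := by
  have hk := k.2
  rcases add_pred_mod_cases k.2 with ⟨h1, h⟩ | ⟨h1, h⟩
  · exact ⟨0, by simp only [latticePos, cyclicPred, h]; omega⟩
  · exact ⟨1, by simp only [latticePos, cyclicPred, h]; omega⟩

/-- For `n ≥ 3` an index and its two cyclic neighbours are distinct, so each row is a sum of three
indicators. -/
theorem periodicMathieu_mulVec (hn : 3 ≤ n) (α β θ : ℝ) (v : Fin n → ℝ) (k : Fin n) :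
    (periodicMathieu n α β θ *ᵥ v) k =
      v (cyclicSucc k) + v (cyclicPred k)
        + 2 * β * Real.cos (2 * Real.pi * α * (latticePos n k : ℝ) + θ) * v k := by
  have hentry : ∀ j, periodicMathieu n α β θ k j * v j =
      (if j = cyclicSucc k then v j else 0) + (if j = cyclicPred k then v j else 0)
        + (if j = k then 2 * β * Real.cos (2 * Real.pi * α * (latticePos n k : ℝ) + θ) * v j
            else 0) := by
    intro j
    have hk := k.2
    have hj := j.2
    simp only [periodicMathieu, Matrix.of_apply, Fin.ext_iff, cyclicSucc, cyclicPred]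
    rcases add_one_mod_cases hk with ⟨a1, a2⟩ | ⟨a1, a2⟩ <;>
    rcases add_one_mod_cases hj with ⟨b1, b2⟩ | ⟨b1, b2⟩ <;>
    rcases add_pred_mod_cases hk with ⟨c1, c2⟩ | ⟨c1, c2⟩ <;>
    rw [a2, b2, c2] <;> split_ifs <;> first | omega | simp
  simp only [Matrix.mulVec, dotProduct, hentry, Finset.sum_add_distrib]
  simp

theorem abs_finiteMathieu_sub_periodicMathieu_mulVec_le (hn : 3 ≤ n) (α β θ : ℝ) (v : Fin n → ℝ)
    (k : Fin n) :
    |(finiteMathieu n α β θ *ᵥ v) k - (periodicMathieu n α β θ *ᵥ v) k| ≤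
      |v ⟨0, by omega⟩| + |v ⟨n - 1, by omega⟩| := by
  have hentry : ∀ j, periodicMathieu n α β θ k j * v j = finiteMathieu n α β θ k j * v j +
      ((if j = ⟨n - 1, by omega⟩ then (if (k : ℕ) = 0 then v j else 0) else 0) +
       (if j = ⟨0, by omega⟩ then (if (k : ℕ) = n - 1 then v j else 0) else 0)) := by
    intro j
    have hk := k.2
    have hj := j.2
    simp only [periodicMathieu, finiteMathieu, Matrix.of_apply, Fin.ext_iff]
    rcases add_one_mod_cases hk with ⟨a1, a2⟩ | ⟨a1, a2⟩ <;>
    rcases add_one_mod_cases hj with ⟨b1, b2⟩ | ⟨b1, b2⟩ <;>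
    rw [a2, b2] <;> split_ifs <;> first | omega | simp
  simp only [Matrix.mulVec, dotProduct, hentry, Finset.sum_add_distrib]
  simp only [Finset.sum_ite_eq', Finset.mem_univ, if_true, sub_add_cancel_left, abs_neg]
  refine (abs_add_le _ _).trans ?_
  rw [add_comm]
  refine add_le_add ?_ ?_ <;> split_ifs <;> simp

end Matrices

/-! ### Approximate eigenvectors of the matrices. -/

section ApproximateEigenvectors

variable {ε : ℝ}

theorem periodicMathieu_mulVec_hermiteVec {n : ℕ} (hn : 3 ≤ n) {α : ℝ} (hα : 0 < α)
    (β γ θ : ℝ) (m : ℕ) (k : Fin n) :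
    (periodicMathieu n α β θ *ᵥ hermiteVec n γ m (θ / (2 * Real.pi * α))) k =
      periodicHermite n γ m ((latticePos n k : ℝ) + θ / (2 * Real.pi * α) + 1)
        + periodicHermite n γ m ((latticePos n k : ℝ) + θ / (2 * Real.pi * α) - 1)
        + 2 * β * Real.cos (2 * Real.pi * α * ((latticePos n k : ℝ) + θ / (2 * Real.pi * α))) *
          periodicHermite n γ m ((latticePos n k : ℝ) + θ / (2 * Real.pi * α)) := by
  have hn0 : 0 < n := by omega
  have hπ := Real.pi_pos
  rw [periodicMathieu_mulVec hn]
  simp only [hermiteVec]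
  obtain ⟨i, hi⟩ := exists_latticePos_cyclicSucc k
  obtain ⟨j, hj⟩ := exists_latticePos_cyclicPred k
  set s := θ / (2 * Real.pi * α) with hs
  have hθ : 2 * Real.pi * α * ((latticePos n k : ℝ) + s) =
      2 * Real.pi * α * (latticePos n k : ℝ) + θ := by
    rw [hs]; field_simp
  have e1 : ((latticePos n (cyclicSucc k) : ℤ) : ℝ) + s = latticePos n k + s + 1 + n * i := by
    rw [hi]; push_cast; ring
  have e2 : ((latticePos n (cyclicPred k) : ℤ) : ℝ) + s = latticePos n k + s - 1 + n * j := by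
    rw [hj]; push_cast; ring
  rw [hθ, e1, e2, periodicHermite_add_mul_int hn0, periodicHermite_add_mul_int hn0]

/-- If `x + s` is wrapped, its residue differs from it by at least `n`, hence has size at least `n -
(n/2 + |s|) ≥ R`. -/
theorem shift_cases {n : ℕ} (hn : 0 < n) {s R : ℝ} (hs : |s| + R ≤ (n : ℝ) / 2) (hR : 0 ≤ R)
    (k : Fin n) :
    |(latticePos n k : ℝ) + s| ≤ n ∧
      (centeredResidue n ((latticePos n k : ℝ) + s) = (latticePos n k : ℝ) + s ∨
        R ≤ |centeredResidue n ((latticePos n k : ℝ) + s)|) := by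
  have hx := abs_latticePos_le k
  set x : ℝ := (latticePos n k : ℝ)
  have hn' : (0 : ℝ) < n := by exact_mod_cast hn
  have hxs : |x + s| ≤ n / 2 + |s| := (abs_add_le x s).trans (by linarith)
  refine ⟨by linarith, ?_⟩
  set q := ⌊(x + s) / (n : ℝ) + 1 / 2⌋ with hq
  have hz : centeredResidue n (x + s) = x + s - n * q := rfl
  rcases eq_or_ne q 0 with h0 | h0
  · left
    rw [hz, h0, Int.cast_zero, mul_zero, sub_zero]
  · right
    have h1 : (1 : ℝ) ≤ |(q : ℝ)| := by exact_mod_cast Int.one_le_abs h0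
    have h2 : |(n : ℝ) * q| ≤ |x + s| + |centeredResidue n (x + s)| := by
      have : (n : ℝ) * q = (x + s) - centeredResidue n (x + s) := by rw [hz]; ring
      rw [this]
      exact abs_sub _ _
    rw [abs_mul, abs_of_pos hn'] at h2
    nlinarith

theorem exists_periodicMathieu_approx (hε0 : 0 < ε) (hε1 : ε < 1) (m : ℕ) :
    ∃ C : ℝ, 0 < C ∧ ∀ (n : ℕ) (α β θ : ℝ), 0 < α → 0 < β →
      4 / (n : ℝ) ^ (2 - ε) < amoGamma α β → amoGamma α β < 1 / (n : ℝ) ^ ε →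
      ((∃ q : ℤ, α * (n : ℝ) = (q : ℝ)) ∨
        |θ| / (2 * Real.pi * α) + √((n : ℝ) ^ ε / amoGamma α β) ≤ (n : ℝ) / 2) →
      ∀ k : Fin n,
        |(periodicMathieu n α β θ *ᵥ
            hermiteVec n (amoGamma α β) m (θ / (2 * Real.pi * α))) k
          - approxEigenvalue β (amoGamma α β) m *
            hermiteVec n (amoGamma α β) m (θ / (2 * Real.pi * α)) k|
          ≤ C * (1 + 1 / β) * amoGamma α β ^ 2 := by
  obtain ⟨C, hC, happ⟩ := exists_periodicHermite_approx hε0 hε1 m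
  refine ⟨C, hC, fun n α β θ hα hβ h1 h2 hcase k => ?_⟩
  have hn3 := three_le_of_regime hε0 hε1 h1 h2
  have hn : 0 < n := by omega
  have happ := happ n α β hα hβ h1 h2
  rw [periodicMathieu_mulVec_hermiteVec hn3 hα, hermiteVec]
  rcases hcase with ⟨q, hq⟩ | hs
  -- For integral `αn` the potential also has period `n`, so `y` may be replaced by its residue.
  · set y := (latticePos n k : ℝ) + θ / (2 * Real.pi * α)
    obtain ⟨j, hj⟩ : ∃ j : ℤ, y = centeredResidue n y + n * j :=
      ⟨⌊y / (n : ℝ) + 1 / 2⌋, by rw [centeredResidue]; ring⟩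
    have hzz : centeredResidue n (centeredResidue n y) = centeredResidue n y :=
      centeredResidue_eq_self hn (neg_half_le_centeredResidue hn y) (centeredResidue_lt_half hn y)
    have hzb : |centeredResidue n y| ≤ n :=
      (abs_centeredResidue_le_half hn y).trans (by have : (0 : ℝ) ≤ n := by positivity
                                                   linarith)
    have key := happ (centeredResidue n y) hzb (Or.inl hzz)
    set z := centeredResidue n y
    have hcos : Real.cos (2 * Real.pi * α * y) = Real.cos (2 * Real.pi * α * z) := by
      have : 2 * Real.pi * α * y = 2 * Real.pi * α * z + ((q * j : ℤ) : ℝ) * (2 * Real.pi) := by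
        rw [hj]; push_cast
        linear_combination (2 * Real.pi * j) * hq
      rw [this, Real.cos_add_int_mul_two_pi]
    have e1 : periodicHermite n (amoGamma α β) m (y + 1) =
        periodicHermite n (amoGamma α β) m (z + 1) := by
      rw [← periodicHermite_add_mul_int hn _ _ (z + 1) j]
      congr 1
      linarith
    have e2 : periodicHermite n (amoGamma α β) m (y - 1) =
        periodicHermite n (amoGamma α β) m (z - 1) := by
      rw [← periodicHermite_add_mul_int hn _ _ (z - 1) j]
      congr 1
      linarith
    have e0 : periodicHermite n (amoGamma α β) m y = periodicHermite n (amoGamma α β) m z := by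
      rw [← periodicHermite_add_mul_int hn _ _ z j]
      congr 1
    rw [hcos, e1, e2, e0]
    exact key
  · have hs' : |θ / (2 * Real.pi * α)| + √((n : ℝ) ^ ε / amoGamma α β) ≤ (n : ℝ) / 2 := by
      rw [abs_div, abs_of_pos (by have := Real.pi_pos; positivity : 0 < 2 * Real.pi * α)]
      exact hs
    obtain ⟨hy, hz⟩ := shift_cases hn hs' (Real.sqrt_nonneg _) k
    exact happ _ hy hz

theorem exists_finiteMathieu_approx (hε0 : 0 < ε) (hε1 : ε < 1) (m : ℕ) :
    ∃ C : ℝ, 0 < C ∧ ∀ (n : ℕ) (α β θ : ℝ), 0 < α → 0 < β →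
      4 / (n : ℝ) ^ (2 - ε) < amoGamma α β → amoGamma α β < 1 / (n : ℝ) ^ ε →
      |θ| / (2 * Real.pi * α) + √((n : ℝ) ^ ε / amoGamma α β) ≤ (n : ℝ) / 2 →
      ∀ k : Fin n,
        |(finiteMathieu n α β θ *ᵥ
            hermiteVec n (amoGamma α β) m (θ / (2 * Real.pi * α))) k
          - approxEigenvalue β (amoGamma α β) m *
            hermiteVec n (amoGamma α β) m (θ / (2 * Real.pi * α)) k|
          ≤ C * (1 + 1 / β) * amoGamma α β ^ 2 := by
  obtain ⟨C, hC, happ⟩ := exists_periodicMathieu_approx hε0 hε1 m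
  obtain ⟨K, hK, htail⟩ := exists_scaledHermite_tail hε0 m
  refine ⟨C + 2 * K, by positivity, fun n α β θ hα hβ h1 h2 hs k => ?_⟩
  have hn3 := three_le_of_regime hε0 hε1 h1 h2
  have hn : 0 < n := by omega
  have hγ := amoGamma_pos hα hβ
  have hγ1 := regime_lt_one hn hε0 hγ h2
  have hone := regime_one_le hn hε0 h1
  have hP := happ n α β θ hα hβ h1 h2 (Or.inr hs) k
  have hs' : |θ / (2 * Real.pi * α)| + √((n : ℝ) ^ ε / amoGamma α β) ≤ (n : ℝ) / 2 := by
    rw [abs_div, abs_of_pos (by have := Real.pi_pos; positivity : 0 < 2 * Real.pi * α)]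
    exact hs
  set γ := amoGamma α β
  set s := θ / (2 * Real.pi * α)
  have hD := abs_finiteMathieu_sub_periodicMathieu_mulVec_le hn3 α β θ (hermiteVec n γ m s) k
  -- The deleted corners multiply only the first and last entries, which lie in the tail even after
  -- the shift by `s`.
  have corner : ∀ i : Fin n, (n : ℝ) / 2 - 1 ≤ |(latticePos n i : ℝ)| →
      |hermiteVec n γ m s i| ≤ K * γ ^ 2 := by
    intro i hi
    have h3 := abs_centeredResidue_le_add hn (latticePos n i : ℝ) s
    rw [centeredResidue_latticePos hn] at h3
    have h4 : (n : ℝ) ^ 4 * |hermiteVec n γ m s i| ≤ K :=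
      htail n γ (centeredResidue n ((latticePos n i : ℝ) + s)) hn hγ hγ1.le (by linarith)
    have h5 : |hermiteVec n γ m s i| * 1 ≤ |hermiteVec n γ m s i| * (γ ^ 2 * (n : ℝ) ^ 4) := by
      gcongr
    have h6 : γ ^ 2 * ((n : ℝ) ^ 4 * |hermiteVec n γ m s i|) ≤ γ ^ 2 * K := by gcongr
    linarith
  have c0 := corner ⟨0, by omega⟩ (by
    have : (n : ℤ) ≤ 2 * -latticePos n ⟨0, by omega⟩ + 2 := by simp only [latticePos]; omega
    have : (n : ℝ) ≤ 2 * -(latticePos n ⟨0, by omega⟩ : ℝ) + 2 := by exact_mod_cast this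
    have := neg_le_abs (latticePos n ⟨0, by omega⟩ : ℝ)
    linarith)
  have c1 := corner ⟨n - 1, by omega⟩ (by
    have : (n : ℤ) ≤ 2 * latticePos n ⟨n - 1, by omega⟩ + 2 := by simp only [latticePos]; omega
    have : (n : ℝ) ≤ 2 * (latticePos n ⟨n - 1, by omega⟩ : ℝ) + 2 := by exact_mod_cast this
    have := le_abs_self (latticePos n ⟨n - 1, by omega⟩ : ℝ)
    linarith)
  have htri := abs_sub_le ((finiteMathieu n α β θ *ᵥ hermiteVec n γ m s) k)
    ((periodicMathieu n α β θ *ᵥ hermiteVec n γ m s) k)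
    (approxEigenvalue β γ m * hermiteVec n γ m s k)
  have q : 0 ≤ 2 * K * (1 / β) * γ ^ 2 := by positivity
  linarith

end ApproximateEigenvectors

/-! ### Spacing of the Hermite zeros. -/

section HermiteZeros

theorem exists_zero_of_mul_nonpos {f : ℝ → ℝ} (hf : Continuous f) {a b : ℝ} (hab : a ≤ b)
    (h : f a * f b ≤ 0) : ∃ x ∈ Set.Icc a b, f x = 0 := by
  rcases mul_nonpos_iff.1 h with ⟨h1, h2⟩ | ⟨h1, h2⟩
  · exact intermediate_value_Icc' hab hf.continuousOn ⟨h2, h1⟩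
  · exact intermediate_value_Icc hab hf.continuousOn ⟨h1, h2⟩

/-- After dividing by `X - r`, the quotient has no zero on `[a, b]`, not even at the simple root
`r`, so it keeps its sign there. -/
theorem Polynomial.eval_mul_eval_neg_of_unique_root {p : Polynomial ℝ} {r a b : ℝ}
    (hr : p.eval r = 0) (hd : p.derivative.eval r ≠ 0) (ha : a < r) (hb : r < b)
    (huniq : ∀ x ∈ Set.Icc a b, p.eval x = 0 → x = r) : p.eval a * p.eval b < 0 := by
  obtain ⟨q, rfl⟩ := Polynomial.dvd_iff_isRoot.2 hr
  have hq : ∀ x ∈ Set.Icc a b, q.eval x ≠ 0 := by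
    intro x hx h0
    have hxr := huniq x hx (by simp [h0])
    subst hxr
    apply hd
    simp [h0]
  have hpos : 0 < q.eval a * q.eval b := by
    by_contra h
    obtain ⟨x, hx, h0⟩ := exists_zero_of_mul_nonpos q.continuous (ha.trans hb).le (not_lt.1 h)
    exact hq x hx h0
  simp only [Polynomial.eval_mul, Polynomial.eval_sub, Polynomial.eval_X, Polynomial.eval_C]
  have : (a - r) * (b - r) < 0 := mul_neg_of_neg_of_pos (by linarith) (by linarith)
  nlinarith

theorem gaussPoly_eq_zero_iff (p : Polynomial ℝ) (u : ℝ) : gaussPoly p u = 0 ↔ p.eval u = 0 := by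
  simp [gaussPoly, (Real.exp_pos _).ne']

theorem continuous_gaussPoly (p : Polynomial ℝ) : Continuous (gaussPoly p) :=
  continuous_iff_continuousAt.2 fun u => (hasDerivAt_gaussPoly p u).continuousAt

/-- A function that vanishes at `e`, has a critical point `c` where `|g| = M`, and satisfies
`|g''| ≤ κ M` in between, needs room `κ (c - e)² ≥ 1`. -/
theorem one_le_mul_sq_of_critical {g g' g'' : ℝ → ℝ} (hg : ∀ x, HasDerivAt g (g' x) x)
    (hg' : ∀ x, HasDerivAt g' (g'' x) x) {e c κ : ℝ} (hκ : 0 ≤ κ) (he : g e = 0) (hc : g' c = 0)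
    (hgc : 0 < |g c|) (hb : ∀ x ∈ Set.uIcc e c, |g'' x| ≤ κ * |g c|) :
    1 ≤ κ * (c - e) ^ 2 := by
  have hconv : Convex ℝ (Set.uIcc e c) := convex_uIcc e c
  -- The mean value inequality is used twice: for `g'` starting from `c`, then for `g` starting from
  -- `e`.
  have h1 : ∀ x ∈ Set.uIcc e c, |g' x| ≤ κ * |g c| * |c - e| := by
    intro x hx
    have := Convex.norm_image_sub_le_of_norm_hasDerivWithin_le
      (fun y _ => (hg' y).hasDerivWithinAt) hb hconv Set.right_mem_uIcc hx
    rw [hc, sub_zero, Real.norm_eq_abs, Real.norm_eq_abs] at this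
    refine this.trans ?_
    gcongr κ * |g c| * ?_
    have h2 := Set.abs_sub_right_of_mem_uIcc hx
    rwa [abs_sub_comm] at h2
  have h2 := Convex.norm_image_sub_le_of_norm_hasDerivWithin_le
    (fun y _ => (hg y).hasDerivWithinAt) h1 hconv Set.left_mem_uIcc Set.right_mem_uIcc
  rw [he, sub_zero, Real.norm_eq_abs, Real.norm_eq_abs] at h2
  have h3 : |g c| * 1 ≤ |g c| * (κ * (c - e) ^ 2) := by
    rw [← sq_abs (c - e)]
    linarith
  exact le_of_mul_le_mul_left h3 hgc

theorem four_lt_mul_sq_sub_of_realHermite_roots {m : ℕ} {a b : ℝ} (hab : a < b)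
    (ha : (realHermite m).eval a = 0) (hb : (realHermite m).eval b = 0) :
    4 < ((m : ℝ) + 1) * (b - a) ^ 2 := by
  set g := gaussPoly (realHermite m) with hg
  have hga : g a = 0 := (gaussPoly_eq_zero_iff _ _).2 ha
  have hgb : g b = 0 := (gaussPoly_eq_zero_iff _ _).2 hb
  -- Maximising `g²` instead of `|g|` keeps the function differentiable.
  obtain ⟨c, hc, hmax⟩ := isCompact_Icc.exists_isMaxOn (Set.nonempty_Icc.2 hab.le)
    ((continuous_gaussPoly (realHermite m)).pow 2).continuousOn
  have hmax' : ∀ x ∈ Set.Icc a b, |g x| ≤ |g c| := fun x hx => sq_le_sq.1 (hmax hx)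
  have hgc : 0 < |g c| := by
    by_contra h
    refine (realHermite_monic m).ne_zero (Polynomial.eq_zero_of_infinite_isRoot _ ?_)
    refine (Set.Icc_infinite hab).mono fun x hx => ?_
    have h1 := (hmax' x hx).trans (not_lt.1 h)
    exact (gaussPoly_eq_zero_iff _ _).1 (abs_nonpos_iff.1 h1)
  have hgc0 : g c ≠ 0 := abs_pos.1 hgc
  have hac : a < c := lt_of_le_of_ne hc.1 fun h => hgc0 (h ▸ hga)
  have hcb : c < b := lt_of_le_of_ne hc.2 fun h => hgc0 (h ▸ hgb)
  have hcrit : gaussPoly (gaussDeriv (realHermite m)) c = 0 := by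
    have h1 := (hmax.isLocalMax (Icc_mem_nhds hac hcb)).hasDerivAt_eq_zero
      ((hasDerivAt_gaussPoly (realHermite m) c).pow 2)
    simpa [hg.symm, hgc0] using h1
  have hbound : ∀ x ∈ Set.Icc a b, |gaussPoly (gaussDeriv (gaussDeriv (realHermite m))) x| ≤
      ((m : ℝ) + 1 / 2) * |g c| := by
    intro x hx
    have ha2 := sq_le_of_realHermite_eval_eq_zero ha
    have hb2 := sq_le_of_realHermite_eval_eq_zero hb
    have hx2 : x ^ 2 ≤ 4 * ((m : ℝ) - 1) := by
      rcases le_total 0 x with h | h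
      · exact (pow_le_pow_left₀ h hx.2 2).trans hb2
      · have := hx.1; nlinarith
    rw [gaussPoly_gaussDeriv_gaussDeriv, abs_mul]
    refine mul_le_mul ?_ (hmax' x hx) (abs_nonneg _) (by positivity)
    rw [abs_le]; constructor <;> nlinarith [sq_nonneg x]
  have hκ : (0 : ℝ) ≤ (m : ℝ) + 1 / 2 := by positivity
  have k1 := one_le_mul_sq_of_critical (hasDerivAt_gaussPoly _) (hasDerivAt_gaussPoly _) hκ hga
    hcrit hgc fun x hx => hbound x (by
      rw [Set.uIcc_of_le hac.le] at hx; exact ⟨hx.1, hx.2.trans hcb.le⟩)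
  have k2 := one_le_mul_sq_of_critical (hasDerivAt_gaussPoly _) (hasDerivAt_gaussPoly _) hκ hgb
    hcrit hgc fun x hx => hbound x (by
      rw [Set.uIcc_of_ge hcb.le] at hx; exact ⟨hac.le.trans hx.1, hx.2⟩)
  have hlt : ((m : ℝ) + 1 / 2) * (b - a) ^ 2 < (m + 1) * (b - a) ^ 2 := by
    have : 0 < (b - a) ^ 2 := by have := sub_pos.2 hab; positivity
    nlinarith
  -- The critical point is within `(b - a)/2` of one of the two roots.
  have h4 : 4 ≤ ((m : ℝ) + 1 / 2) * (b - a) ^ 2 := by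
    rcases le_total (c - a) (b - c) with h | h
    · have : 4 * (c - a) ^ 2 ≤ (b - a) ^ 2 := by nlinarith
      nlinarith
    · have : 4 * (c - b) ^ 2 ≤ (b - a) ^ 2 := by nlinarith
      nlinarith
  linarith

end HermiteZeros

/-! ### Sign changes of sampled functions. -/

section SignChanges

variable {n : ℕ}

theorem latticePos_lt_iff {k l : Fin n} : latticePos n k < latticePos n l ↔ k < l := by
  rw [Fin.lt_def]; unfold latticePos; omega

theorem latticePos_injective : Function.Injective (latticePos n) := fun k l h => by
  unfold latticePos at h
  ext
  omega

theorem exists_latticePos_eq {t : ℤ} (ht : |(t : ℝ)| < (n : ℝ) / 2) :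
    ∃ k : Fin n, latticePos n k = t := by
  rw [abs_lt] at ht
  have h1 : -(n : ℤ) < 2 * t := by
    have : -(n : ℝ) < 2 * t := by linarith
    exact_mod_cast this
  have h2 : 2 * t < (n : ℤ) := by
    have : 2 * (t : ℝ) < n := by linarith
    exact_mod_cast this
  refine ⟨⟨(t + (n / 2 : ℕ)).toNat, by omega⟩, ?_⟩
  simp only [latticePos]
  omega

/-- If the zeros of a continuous function are simple and more than `1` apart, then sampling it
at integers yields as many sign changes as there are zeros. -/
theorem signChanges_latticePos_eq_card {F : ℝ → ℝ} (hF : Continuous F) (Z : Finset ℝ)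
    (hZ : ∀ x, F x = 0 ↔ x ∈ Z) (hgap : ∀ a ∈ Z, ∀ b ∈ Z, a < b → 1 < b - a)
    (hrange : ∀ a ∈ Z, |a| + 1 < (n : ℝ) / 2)
    (hsign : ∀ r ∈ Z, ∀ a b, a < r → r < b → (∀ x ∈ Set.Icc a b, x ∈ Z → x = r) → F a * F b < 0) :
    signChanges (fun k : Fin n => F (latticePos n k)) = Z.card := by
  -- A zero `r` corresponds to the last integer strictly before it and the first strictly after it.
  -- If `r` is an integer, this pair skips the zero entry at `r`.
  have hex : ∀ r : ℝ, r ∈ Z → ∃ p : Fin n × Fin n,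
      latticePos n p.1 = ⌈r⌉ - 1 ∧ latticePos n p.2 = ⌊r⌋ + 1 := by
    intro r hr
    have h := hrange r hr
    have h1 := Int.le_ceil r
    have h2 := Int.ceil_lt_add_one r
    have h3 := Int.floor_le r
    have h4 := Int.lt_floor_add_one r
    have h5 := neg_abs_le r
    have h6 := le_abs_self r
    obtain ⟨k, hk⟩ := exists_latticePos_eq (n := n) (t := ⌈r⌉ - 1) (by
      push_cast; rw [abs_lt]; constructor <;> linarith)
    obtain ⟨l, hl⟩ := exists_latticePos_eq (n := n) (t := ⌊r⌋ + 1) (by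
      push_cast; rw [abs_lt]; constructor <;> linarith)
    exact ⟨(k, l), hk, hl⟩
  choose f hf1 hf2 using hex
  have hleft : ∀ r, r - 1 ≤ ((⌈r⌉ - 1 : ℤ) : ℝ) ∧ ((⌈r⌉ - 1 : ℤ) : ℝ) < r := fun r => by
    have h1 := Int.le_ceil r
    have h2 := Int.ceil_lt_add_one r
    push_cast
    constructor <;> linarith
  have hright : ∀ r, r < ((⌊r⌋ + 1 : ℤ) : ℝ) ∧ ((⌊r⌋ + 1 : ℤ) : ℝ) ≤ r + 1 := fun r => by
    have h3 := Int.floor_le r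
    have h4 := Int.lt_floor_add_one r
    push_cast
    constructor <;> linarith
  rw [signChanges, ← Set.ncard_coe_finset]
  symm
  refine Set.ncard_congr (fun r hr => f r hr) (fun r hr => ?_) (fun r s hr hs hrs => ?_)
    (fun p hp => ?_)
  · have hr' : r ∈ Z := hr
    have e1 : (latticePos n (f r hr).1 : ℝ) = ((⌈r⌉ - 1 : ℤ) : ℝ) := by rw [hf1]
    have e2 : (latticePos n (f r hr).2 : ℝ) = ((⌊r⌋ + 1 : ℤ) : ℝ) := by rw [hf2]
    refine ⟨?_, ?_, fun k hk1 hk2 => ?_⟩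
    · rw [← latticePos_lt_iff]
      have : (latticePos n (f r hr).1 : ℝ) < (latticePos n (f r hr).2 : ℝ) := by
        rw [e1, e2]; exact (hleft r).2.trans (hright r).1
      exact_mod_cast this
    · simp only [e1, e2]
      refine hsign r hr' _ _ (hleft r).2 (hright r).1 fun x hx hxZ => ?_
      rcases lt_trichotomy x r with h | h | h
      · have := hgap x hxZ r hr' h
        have := (hleft r).1
        have := hx.1
        linarith
      · exact h
      · have := hgap r hr' x hxZ h
        have := (hright r).2
        have := hx.2
        linarith
    · rw [← latticePos_lt_iff, hf1] at hk1
      rw [← latticePos_lt_iff, hf2] at hk2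
      have h1 : r ≤ (latticePos n k : ℝ) := Int.ceil_le.1 (by linarith)
      have h2 : (latticePos n k : ℝ) ≤ r := Int.le_floor.1 (by linarith)
      change F (latticePos n k) = 0
      rw [le_antisymm h2 h1]
      exact (hZ r).2 hr'
  · have hr' : r ∈ Z := hr
    have hs' : s ∈ Z := hs
    have hceil : ⌈r⌉ - 1 = ⌈s⌉ - 1 := by rw [← hf1 r hr, ← hf1 s hs, hrs]
    have h1 := hleft r
    have h2 := hleft s
    rw [hceil] at h1
    rcases lt_trichotomy r s with h | h | h
    · have := hgap r hr' s hs' h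
      linarith
    · exact h
    · have := hgap s hs' r hr' h
      linarith
  · obtain ⟨hlt, hneg, hzero⟩ := hp
    have hlt' : (latticePos n p.1 : ℝ) < (latticePos n p.2 : ℝ) := by
      exact_mod_cast latticePos_lt_iff.2 hlt
    obtain ⟨r, hr, hr0⟩ := exists_zero_of_mul_nonpos hF hlt'.le hneg.le
    have hrZ : r ∈ Z := (hZ r).1 hr0
    have h1 : (latticePos n p.1 : ℝ) < r := lt_of_le_of_ne hr.1 fun h => by
      rw [h, hr0, zero_mul] at hneg; exact lt_irrefl _ hneg
    have h2 : r < (latticePos n p.2 : ℝ) := lt_of_le_of_ne hr.2 fun h => by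
      rw [← h, hr0, mul_zero] at hneg; exact lt_irrefl _ hneg
    have e1 : (latticePos n (f r hrZ).1 : ℝ) = ((⌈r⌉ - 1 : ℤ) : ℝ) := by rw [hf1]
    have e2 : (latticePos n (f r hrZ).2 : ℝ) = ((⌊r⌋ + 1 : ℤ) : ℝ) := by rw [hf2]
    refine ⟨r, hrZ, Prod.ext ?_ ?_⟩
    -- Otherwise `⌈r⌉ - 1` lies strictly inside the pair, hence is a zero at distance at most 1 from
    -- `r`, against the gap.
    · by_contra hne
      have hle : latticePos n p.1 ≤ latticePos n (f r hrZ).1 := by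
        rw [hf1]
        have := Int.lt_ceil.2 h1
        linarith
      have hlt1 := lt_of_le_of_ne hle fun h => hne (latticePos_injective h).symm
      have hlt2 : latticePos n (f r hrZ).1 < latticePos n p.2 := by
        have : (latticePos n (f r hrZ).1 : ℝ) < latticePos n p.2 := by
          rw [e1]; exact (hleft r).2.trans h2
        exact_mod_cast this
      have h0 := hzero _ (latticePos_lt_iff.1 hlt1) (latticePos_lt_iff.1 hlt2)
      rw [e1] at h0
      have := hgap _ ((hZ _).1 h0) r hrZ (hleft r).2
      have := (hleft r).1
      linarith
    · by_contra hne
      have hle : latticePos n (f r hrZ).2 ≤ latticePos n p.2 := by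
        rw [hf2]
        have := Int.floor_lt.2 h2
        linarith
      have hlt1 := lt_of_le_of_ne hle fun h => hne (latticePos_injective h)
      have hlt2 : latticePos n p.1 < latticePos n (f r hrZ).2 := by
        have : (latticePos n p.1 : ℝ) < latticePos n (f r hrZ).2 := by
          rw [e2]; exact h1.trans (hright r).1
        exact_mod_cast this
      have h0 := hzero _ (latticePos_lt_iff.1 hlt2) (latticePos_lt_iff.1 hlt1)
      rw [e2] at h0
      have := hgap r hrZ _ ((hZ _).1 h0) (hright r).1
      have := (hright r).2
      linarith

theorem signChanges_scaledHermite {γ : ℝ} (hγ : 0 < γ) {m : ℕ} (hm : γ * ((m : ℝ) + 1) < 1)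
    (hrange : 4 * ((m : ℝ) + 1) < γ * (n : ℝ) ^ 2) :
    signChanges (fun k : Fin n => scaledHermite γ m (latticePos n k)) = m := by
  have hsγ : 0 < √γ := Real.sqrt_pos.2 hγ
  have hsq : √γ ^ 2 = γ := Real.sq_sqrt hγ.le
  have hc : 0 < 2 * √γ := by positivity
  have hF : ∀ x, scaledHermite γ m x =
      √2 ^ m * (Real.exp (-((2 * √γ * x) ^ 2 / 4)) * (realHermite m).eval (2 * √γ * x)) :=
    scaledHermite_eq γ hγ.le m
  have hFpos : ∀ x, 0 < √2 ^ m * Real.exp (-((2 * √γ * x) ^ 2 / 4)) := fun x => by positivity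
  have hinj : Function.Injective fun u : ℝ => u / (2 * √γ) := fun u v h => by
    simpa [hsγ.ne'] using h
  have hmem : ∀ x, x ∈ (realHermite m).roots.toFinset.image (fun u => u / (2 * √γ)) ↔
      (realHermite m).eval (2 * √γ * x) = 0 := by
    intro x
    simp only [Finset.mem_image, Multiset.mem_toFinset,
      Polynomial.mem_roots (realHermite_monic m).ne_zero, Polynomial.IsRoot.def]
    constructor
    · rintro ⟨u, hu, rfl⟩
      rwa [mul_div_cancel₀ _ hc.ne']
    · intro h
      exact ⟨_, h, by rw [mul_div_cancel_left₀ _ hc.ne']⟩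
  rw [signChanges_latticePos_eq_card (F := scaledHermite γ m) ?_
    ((realHermite m).roots.toFinset.image fun u => u / (2 * √γ)) ?_ ?_ ?_ ?_,
    Finset.card_image_of_injective _ hinj, card_realHermite_roots]
  · rw [funext hF]
    exact continuous_const.mul ((by fun_prop : Continuous fun x : ℝ =>
      Real.exp (-((2 * √γ * x) ^ 2 / 4))).mul
      ((realHermite m).continuous.comp (by fun_prop)))
  · intro x
    rw [hmem, hF, ← mul_assoc, mul_eq_zero, or_iff_right (hFpos x).ne']
  · intro a ha b hb hab
    have h := four_lt_mul_sq_sub_of_realHermite_roots (mul_lt_mul_of_pos_left hab hc)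
      ((hmem a).1 ha) ((hmem b).1 hb)
    have e : (2 * √γ * b - 2 * √γ * a) ^ 2 = 4 * γ * (b - a) ^ 2 := by
      linear_combination (4 * (b - a) ^ 2) * hsq
    rw [e] at h
    by_contra h1
    have h2 : (b - a) ^ 2 ≤ 1 := by nlinarith
    have h3 : 0 ≤ γ * ((m : ℝ) + 1) := by positivity
    nlinarith
  · intro a ha
    have h := sq_le_of_realHermite_eval_eq_zero ((hmem a).1 ha)
    have e : (2 * √γ * a) ^ 2 = 4 * γ * |a| ^ 2 := by
      rw [sq_abs]; linear_combination (4 * a ^ 2) * hsq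
    rw [e] at h
    have h0 := abs_nonneg a
    by_contra h1
    have h2 : ((n : ℝ) / 2) ^ 2 ≤ (|a| + 1) ^ 2 := pow_le_pow_left₀ (by positivity) (not_lt.1 h1) 2
    have h3 : γ * ((n : ℝ) / 2) ^ 2 ≤ γ * (|a| + 1) ^ 2 := by gcongr
    have h4 : γ * (γ * |a| ^ 2) ≤ γ * ((m : ℝ) - 1) := by
      apply mul_le_mul_of_nonneg_left _ hγ.le
      linarith
    -- It gives `2γ|a| ≤ 1 + γ²a² ≤ 1 + γ(m-1)`, so `γ(|a|+1)² ≤ m + γm < m + 1 < γn²/4`.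
    have h5 := sq_nonneg (γ * |a| - 1)
    nlinarith
  · intro r hr a b ha hb huniq
    have hr' := (hmem r).1 hr
    have key := Polynomial.eval_mul_eval_neg_of_unique_root hr' (realHermite_derivative_ne_zero hr')
      (mul_lt_mul_of_pos_left ha hc) (mul_lt_mul_of_pos_left hb hc) (fun x hx hx0 => by
        have hx1 : 2 * √γ * (x / (2 * √γ)) = x := mul_div_cancel₀ _ hc.ne'
        have := huniq (x / (2 * √γ))
          ⟨by rw [le_div_iff₀ hc]; linarith [hx.1], by rw [div_le_iff₀ hc]; linarith [hx.2]⟩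
          ((hmem _).2 (by rw [hx1]; exact hx0))
        rw [← hx1, this])
    rw [hF, hF, ← mul_assoc, ← mul_assoc]
    have := mul_pos (hFpos a) (hFpos b)
    calc _ = (√2 ^ m * Real.exp (-((2 * √γ * a) ^ 2 / 4)) *
          (√2 ^ m * Real.exp (-((2 * √γ * b) ^ 2 / 4)))) *
          ((realHermite m).eval (2 * √γ * a) * (realHermite m).eval (2 * √γ * b)) := by ring
      _ < 0 := mul_neg_of_pos_of_neg this key

end SignChanges

/-! ### The main theorem. -/

theorem theorem2p3 (ε : ℝ) (hε0 : 0 < ε) (hε1 : ε < 1) :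
    -- approximate eigenvectors
    (∀ N : ℕ, ∃ C : ℝ, 0 < C ∧
      ∀ (n : ℕ) (α β θ : ℝ), 0 < α → 0 < β →
        4 / (n : ℝ) ^ (2 - ε) < amoGamma α β → amoGamma α β < 1 / (n : ℝ) ^ ε →
        ∀ m : ℕ, m ≤ N →
          (((∃ q : ℤ, α * (n : ℝ) = (q : ℝ)) ∨
              |θ| / (2 * Real.pi * α) + √((n : ℝ) ^ ε / amoGamma α β) ≤ (n : ℝ) / 2) →
            ∀ k : Fin n,
              |(periodicMathieu n α β θ *ᵥ
                  hermiteVec n (amoGamma α β) m (θ / (2 * Real.pi * α))) k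
                - approxEigenvalue β (amoGamma α β) m *
                  hermiteVec n (amoGamma α β) m (θ / (2 * Real.pi * α)) k|
                ≤ C * (1 + 1 / β) * amoGamma α β ^ 2) ∧
          (|θ| / (2 * Real.pi * α) + √((n : ℝ) ^ ε / amoGamma α β) ≤ (n : ℝ) / 2 →
            ∀ k : Fin n,
              |(finiteMathieu n α β θ *ᵥ
                  hermiteVec n (amoGamma α β) m (θ / (2 * Real.pi * α))) k
                - approxEigenvalue β (amoGamma α β) m *
                  hermiteVec n (amoGamma α β) m (θ / (2 * Real.pi * α)) k|
                ≤ C * (1 + 1 / β) * amoGamma α β ^ 2)) ∧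
    -- exponential decay
    (∀ m : ℕ, ∃ C₁ C₂ : ℝ, 0 < C₁ ∧ 0 < C₂ ∧
      ∀ (n : ℕ) (α β : ℝ), 0 < α → 0 < β →
        4 / (n : ℝ) ^ (2 - ε) < amoGamma α β → amoGamma α β < 1 / (n : ℝ) ^ ε →
        ∀ k : Fin n,
          |hermiteVec n (amoGamma α β) m 0 k|
            ≤ C₁ * Real.exp (-(C₂ * √(amoGamma α β) * |(latticePos n k : ℝ)|))) ∧
    -- sign changes
    (∀ (n : ℕ) (α β : ℝ), 0 < α → 0 < β →
      4 / (n : ℝ) ^ (2 - ε) < amoGamma α β → amoGamma α β < 1 / (n : ℝ) ^ ε →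
      ∀ m : ℕ, (m : ℝ) + 1 < (n : ℝ) ^ ε →
        signChanges (hermiteVec n (amoGamma α β) m 0) = m) := by
  refine ⟨fun N => ?_, fun m => ?_, ?_⟩
  · choose C hC hP using exists_periodicMathieu_approx hε0 hε1
    choose D hD hH using exists_finiteMathieu_approx hε0 hε1
    -- Summing the constants gives a single one for both matrices and all `m ≤ N`.
    have hsum : ∀ m ≤ N, C m + D m ≤ ∑ i ∈ Finset.range (N + 1), (C i + D i) := fun m hm =>
      Finset.single_le_sum (f := fun i => C i + D i)
        (fun i _ => (add_pos (hC i) (hD i)).le) (Finset.mem_range.2 (by omega))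
    refine ⟨∑ i ∈ Finset.range (N + 1), (C i + D i),
      lt_of_lt_of_le (add_pos (hC 0) (hD 0)) (hsum 0 (Nat.zero_le N)), ?_⟩
    intro n α β θ hα hβ h1 h2 m hm
    have hs := hsum m hm
    have hCm := hC m
    have hDm := hD m
    refine ⟨fun hcase k => (hP m n α β θ hα hβ h1 h2 hcase k).trans ?_,
      fun hcase k => (hH m n α β θ hα hβ h1 h2 hcase k).trans ?_⟩ <;>
    · gcongr
      linarith
  · obtain ⟨C₁, hC₁, h⟩ := exists_scaledHermite_exp_decay m
    refine ⟨C₁, 1, hC₁, one_pos, fun n α β hα hβ h1 h2 k => ?_⟩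
    rw [hermiteVec_zero (by have := three_le_of_regime hε0 hε1 h1 h2; omega)]
    exact h _ _ (amoGamma_pos hα hβ)
  · intro n α β hα hβ h1 h2 m hm
    have hγ := amoGamma_pos hα hβ
    have hn : 0 < n := by have := three_le_of_regime hε0 hε1 h1 h2; omega
    rw [funext (hermiteVec_zero hn (amoGamma α β) m)]
    refine signChanges_scaledHermite hγ ?_ ?_
    · have := regime_mul_lt_one hn h2
      nlinarith
    · have := regime_rpow_lt hn h1
      linarith
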